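/- Let $\mathbb{T}=\mathbb{R}/\mathbb{Z}$ be the circle with its geodesic distance $d(\overline{x},\overline{y})=\inf_{k\in\mathbb{Z}}|x-y-k|$ and with the probability measure $\mu$ that is the projection of the Lebesgue measure. For a metric space $S$ of diameter at most $1$ with a Borel probability measure $\lambda$, put $$\Phi(S,d,\lambda)=\int_{S^3} d(x,y)\,d(y,z)\,\lambda^{\otimes 3}(dx\,dy\,dz).$$ Let $X_1,X_2,\dots$ be independent random points of $\mathbb{T}$ with law $\mu$, and let $$\Phi_n=\Phi\Big(\{X_1,\dots,X_n\},d,\tfrac1n\sum_{i=1}^n\delta_{X_i}\Big)=\frac1{n^3}\sum_{1\le i,j,k\le n}d(X_i,X_j)\,d(X_j,X_k).$$ Then $n^2\,\mathrm{var}(\Phi_n)\to\sigma_{\mathrm{hom}}^2=\frac{269}{40320}$ as $n\to\infty$, and the random variables $$\frac{\Phi_n-\mathbb{E}[\Phi_n]}{\sqrt{\mathrm{var}(\Phi_n)}}$$ converge in distribution to a law $\nu$ on $\mathbb{R}$ with finite moments of all orders, which is centered, has variance $1$, and has third cumulant $$-\frac{168836}{44385}\sqrt{\frac{70}{269}}\simeq-1.94044$$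 (with an error smaller than $10^{-5}$). In particular, $\nu$ is not a Gaussian distribution. If one subtracts $\Phi(\mathbb{T},d,\mu)$ instead of $\mathbb{E}[\Phi_n]$, then the random variables $$\frac{\Phi_n-\Phi(\mathbb{T},d,\mu)}{\sqrt{\mathrm{var}(\Phi_n)}}$$ converge in distribution to the translate of $\nu$ by the constant $-\frac52\sqrt{\frac{70}{269}}$. -/

import Mathlib

open MeasureTheory ProbabilityTheory Filter Topology
open scoped ENNReal

noncomputable section

/-- An unoriented graph on the vertex set `Fin p`, possibly with loops and multiple edges,
given by its multiset of edges. -/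
abbrev Multigraph (p : ℕ) : Type := Multiset (Sym2 (Fin p))

/-- The path on three vertices. -/
def Multigraph.path3 : Multigraph 3 := {s(0, 1), s(1, 2)}

/-- `F_G(x_1, …, x_p) = ∏_{{i,j} ∈ E(G)} min(1, d(x_i, x_j))`. -/
def Multigraph.distProd {p : ℕ} (G : Multigraph p) {S : Type*} [PseudoMetricSpace S]
    (x : Fin p → S) : ℝ :=
  (G.map (Sym2.lift ⟨fun i j => min 1 (dist (x i) (x j)),
    fun i j => by simp only [dist_comm]⟩)).prod

/-- The monomial observable `M_G` of the metric measure space `(S, d, μ)`: the integral of `F_G`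
against the `p`-fold product of `μ`. -/
def monomialObservable {p : ℕ} (G : Multigraph p) {S : Type*} [PseudoMetricSpace S]
    [MeasurableSpace S] (μ : Measure S) : ℝ :=
  ∫ x : Fin p → S, G.distProd x ∂(Measure.pi fun _ => μ)

/-- The empirical measure `(1/n) ∑_{i < n} δ_{x_i}`. -/
def empiricalMeasure {S : Type*} [MeasurableSpace S] (n : ℕ) (x : ℕ → S) : Measure S :=
  (n : ℝ≥0∞)⁻¹ • ∑ i ∈ Finset.range n, Measure.dirac (x i)

/-- The value `M_G(𝒳_n)` of the monomial observable on the sample model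
`𝒳_n = ({X_0, …, X_{n-1}}, d, (1/n) ∑_{i < n} δ_{X_i})`. As the empirical measure is carried by
the sample points, the integral may be taken over the ambient space. -/
def sampleObservable {p : ℕ} (G : Multigraph p) {S : Type*} [PseudoMetricSpace S]
    [MeasurableSpace S] {Ω : Type*} (X : ℕ → Ω → S) (n : ℕ) (ω : Ω) : ℝ :=
  monomialObservable G (empiricalMeasure n fun i => X i ω)

/-- The formal moment generating series `∑_k E[Y^k] t^k / k!`. -/
def momentSeries {Ω : Type*} [MeasurableSpace Ω] (Y : Ω → ℝ) (P : Measure Ω) : PowerSeries ℝ :=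
  PowerSeries.mk fun k => moment Y k P / (k.factorial : ℝ)

/-- The `r`-th cumulant `r! [t^r] log E[e^{tY}]`, where the logarithm of the formal moment
generating series is `log (1 + U) = ∑_{j ≥ 1} (-1)^{j+1} U^j / j`. Since `U` has no constant term,
only `j ≤ r` contributes to the coefficient of `t^r`. -/
def cumulant (r : ℕ) {Ω : Type*} [MeasurableSpace Ω] (Y : Ω → ℝ) (P : Measure Ω) : ℝ :=
  (r.factorial : ℝ) * ∑ j ∈ Finset.Icc 1 r,
    ((-1 : ℝ) ^ (j + 1) / (j : ℝ)) * PowerSeries.coeff r ((momentSeries Y P - 1) ^ j)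

end

/-! Expand the distance kernel of the circle in its eigenfunctions: d(x,y) = 1/4 + ∑ a_m e_m(x)
e_m(y), where the e_m are √2 cos and √2 sin of odd frequency 2j+1 and a_m = -1/(π²(2j+1)²), an
absolutely summable family. The only constant term is 1/4: the mean distance to a point does not
depend on the point. Hence Φ_n has no fluctuation of order n^(-1/2), and the relevant scale is 1/n.

Put z_m = n^(-1/2) ∑_i e_m(X_i). Then Φ_n = (1/n) ∑_j (1/4 + n^(-1/2) G_j)² with G_j = ∑_m a_m
e_m(X_j) z_m, so that n(Φ_n - 1/16) = (1/2) ∑_m a_m z_m² + (1/n) ∑_j G_j². For finitely many m, the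
central limit theorem sends z_m to independent standard Gaussians ξ_m, and the law of large numbers
sends (1/n) ∑_j e_m(X_j) e_l(X_j) to δ_{ml}. The limit is ∑ c_m ξ_m² with c_m = a_m/2 + a_m²
(`tendstoInDistribution_fluctuation`).

Truncating the expansion to finitely many m is harmless because the z_m are bounded in L⁸ uniformly
in m and n, by Hoeffding's lemma. The fluctuation is quadratic in the z_m, so this gives errors in
L⁴ controlled by the tail of ∑ |a_m|, uniformly in n. The resulting L⁴ bound makes the means and
variances converge as well.

A centered term c(ξ² - 1) has variance 2c² and third moment 8c³, and these add over independent
terms (`hasCenteredMoments_weightedChiSq`). The sums of c_m, c_m², c_m³ reduce to ∑ (2j+1)^(-2r),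
hence to Bernoulli numbers (`hasSum_circleWeight`); the powers of π cancel. The third cumulant is
nonzero, which rules out a Gaussian limit, and the nonzero mean -5/48 of the limit produces the
final translation. -/

/-! ### Minkowski's inequality for countable sums. -/

section Lp

variable {Ω ι : Type*} {mΩ : MeasurableSpace Ω} {μ : Measure Ω}

/-- Minkowski's inequality for countable sums. -/
theorem eLpNorm_tsum_le [Countable ι] {p : ℝ≥0∞} (hp : 1 ≤ p) {f : ι → Ω → ℝ}
    (hf : ∀ i, AEStronglyMeasurable (f i) μ) :
    eLpNorm (fun ω => ∑' i, f i ω) p μ ≤ ∑' i, eLpNorm (f i) p μ := by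
  by_cases h : ∑' i, eLpNorm (f i) p μ = ∞
  · simp [h]
  -- As `ι` is countable, the limit along finite sets can be taken along a sequence, and the
  -- Fatou-type bound for `eLpNorm` applies.
  obtain ⟨s, hs⟩ := exists_seq_tendsto (atTop : Filter (Finset ι))
  have hlim : ∀ᵐ ω ∂μ, Tendsto (fun n => (∑ i ∈ s n, f i) ω) atTop (𝓝 (∑' i, f i ω)) := by
    filter_upwards [summable_norm_of_tsum_eLpNorm_ne_top hp hf h] with ω hω
    simp only [Finset.sum_apply]
    exact hω.of_norm.hasSum.comp hs
  refine (Lp.eLpNorm_lim_le_liminf_eLpNorm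
    (fun n => Finset.aestronglyMeasurable_sum _ fun i _ => hf i) _ hlim).trans ?_
  refine liminf_le_of_le (by isBoundedDefault) fun b hb => ?_
  obtain ⟨n, hn⟩ := hb.exists
  exact hn.trans ((eLpNorm_sum_le (fun i _ => hf i) hp).trans (ENNReal.sum_le_tsum _))

theorem eLpNorm_const_mul_le (c : ℝ) (f : Ω → ℝ) (p : ℝ≥0∞) :
    eLpNorm (fun ω => c * f ω) p μ ≤ ‖c‖ₑ * eLpNorm f p μ :=
  eLpNorm_const_smul_le (c := c) (f := f)

/-- Minkowski's inequality for a weighted countable sum of functions bounded in `L^p`. -/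
theorem eLpNorm_tsum_mul_le [Countable ι] {p : ℝ≥0∞} (hp : 1 ≤ p) {f : ι → Ω → ℝ}
    (hf : ∀ i, AEStronglyMeasurable (f i) μ) {C : ℝ≥0∞} (hC : ∀ i, eLpNorm (f i) p μ ≤ C)
    (a : ι → ℝ) :
    eLpNorm (fun ω => ∑' i, a i * f i ω) p μ ≤ (∑' i, ‖a i‖ₑ) * C := by
  refine (eLpNorm_tsum_le hp fun i => (hf i).const_mul (a i)).trans ?_
  rw [← ENNReal.tsum_mul_right]
  refine ENNReal.tsum_le_tsum fun i => ?_
  exact (eLpNorm_const_mul_le _ _ _).trans (by gcongr; exact hC i)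

theorem eLpNorm_sq (f : Ω → ℝ) (p : ℝ≥0∞) :
    eLpNorm (fun ω => f ω ^ 2) p μ = eLpNorm f (2 * p) μ ^ 2 := by
  have := eLpNorm_norm_rpow (μ := μ) f (p := p) (q := 2) (by norm_num)
  simp only [Real.norm_eq_abs, Real.rpow_ofNat, sq_abs, ENNReal.ofReal_ofNat, ENNReal.rpow_ofNat]
    at this
  rw [this, mul_comm]

end Lp

/-! ### Convergence in distribution: approximation in L¹ and convergence of means. -/

section ConvergenceInDistribution

variable {Ω Ω' : Type*} {mΩ : MeasurableSpace Ω} {mΩ' : MeasurableSpace Ω'}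
  {P : Measure Ω} [IsProbabilityMeasure P] {P' : Measure Ω'} [IsProbabilityMeasure P']

/-- The map u ↦ exp(itu) is |t|-Lipschitz. -/
theorem norm_charFun_map_sub_le {U V : Ω → ℝ} (hU : AEMeasurable U P) (hV : AEMeasurable V P)
    {ε : ℝ} (hε : 0 ≤ ε) (h : eLpNorm (fun ω => V ω - U ω) 1 P ≤ ENNReal.ofReal ε) (t : ℝ) :
    ‖charFun (P.map V) t - charFun (P.map U) t‖ ≤ |t| * ε := by
  have hintg : Integrable (fun ω => V ω - U ω) P :=
    memLp_one_iff_integrable.1 ⟨(hV.sub hU).aestronglyMeasurable, h.trans_lt ENNReal.ofReal_lt_top⟩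
  have hexp : ∀ W : Ω → ℝ, AEMeasurable W P →
      charFun (P.map W) t = ∫ ω, Complex.exp (t * W ω * Complex.I) ∂P ∧
      Integrable (fun ω => Complex.exp (t * W ω * Complex.I)) P := by
    intro W hW
    constructor
    · rw [charFun_apply_real, integral_map hW (by fun_prop)]
    · refine Integrable.of_bound (C := 1) (by fun_prop) (ae_of_all _ fun ω => ?_)
      rw [← Complex.ofReal_mul, Complex.norm_exp_ofReal_mul_I]
  rw [(hexp V hV).1, (hexp U hU).1, ← integral_sub (hexp V hV).2 (hexp U hU).2]
  calc _ ≤ ∫ ω, |t| * ‖V ω - U ω‖ ∂P := by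
        refine norm_integral_le_of_norm_le (hintg.norm.const_mul _) (ae_of_all _ fun ω => ?_)
        have h1 : Complex.exp (t * V ω * Complex.I) - Complex.exp (t * U ω * Complex.I)
            = Complex.exp ((t * U ω : ℝ) * Complex.I)
              * (Complex.exp (Complex.I * (t * (V ω - U ω) : ℝ)) - 1) := by
          rw [mul_sub, ← Complex.exp_add]; push_cast; ring_nf
        rw [h1, norm_mul, Complex.norm_exp_ofReal_mul_I, one_mul]
        refine (Real.norm_exp_I_mul_ofReal_sub_one_le).trans ?_
        rw [norm_mul, Real.norm_eq_abs t]
    _ = |t| * ∫ ω, ‖V ω - U ω‖ ∂P := integral_const_mul _ _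
    _ ≤ |t| * ε := by
        gcongr
        rw [eLpNorm_one_eq_lintegral_enorm, ← ofReal_integral_norm_eq_lintegral_enorm hintg] at h
        exact (ENNReal.ofReal_le_ofReal_iff hε).1 h

/-- Convergence in distribution follows from that of `L¹` approximations, uniform in `n`. -/
theorem tendstoInDistribution_of_approx {V : ℕ → Ω → ℝ} {V' : Ω' → ℝ}
    (hV : ∀ n, AEMeasurable (V n) P) (hV' : AEMeasurable V' P')
    (h : ∀ ε : ℝ, 0 < ε → ∃ (U : ℕ → Ω → ℝ) (U' : Ω' → ℝ),
      TendstoInDistribution U atTop U' (fun _ => P) P' ∧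
      (∀ n, eLpNorm (fun ω => V n ω - U n ω) 1 P ≤ ENNReal.ofReal ε) ∧
      eLpNorm (fun ω => V' ω - U' ω) 1 P' ≤ ENNReal.ofReal ε) :
    TendstoInDistribution V atTop V' (fun _ => P) P' := by
  refine ⟨hV, hV', ?_⟩
  refine ProbabilityMeasure.tendsto_iff_tendsto_charFun.2 fun t => ?_
  rw [Metric.tendsto_atTop]
  intro δ hδ
  -- With this ε each of the three errors is at most δ/4; the +1 covers t = 0.
  have hc : 0 < 4 * (|t| + 1) := by positivity
  obtain ⟨U, U', hU, h1, h2⟩ := h (δ / (4 * (|t| + 1))) (by positivity)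
  have hUt := (ProbabilityMeasure.tendsto_iff_tendsto_charFun.1 hU.tendsto) t
  rw [Metric.tendsto_atTop] at hUt
  obtain ⟨N, hN⟩ := hUt (δ / 4) (by positivity)
  have hb : |t| * (δ / (4 * (|t| + 1))) ≤ δ / 4 := by
    rw [mul_div_assoc', div_le_div_iff₀ hc (by norm_num)]
    nlinarith [abs_nonneg t]
  refine ⟨N, fun n hn => ?_⟩
  have e1 := (norm_charFun_map_sub_le (hU.forall_aemeasurable n) (hV n)
    (by positivity) (h1 n) t).trans hb
  have e2 := hN n hn
  have e3 := (norm_charFun_map_sub_le hU.aemeasurable_limit hV' (by positivity) h2 t).trans hb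
  simp only [ProbabilityMeasure.coe_mk, dist_eq_norm] at e2 ⊢
  calc _ = ‖(charFun (P.map (V n)) t - charFun (P.map (U n)) t)
        + (charFun (P.map (U n)) t - charFun (P'.map U') t)
        - (charFun (P'.map V') t - charFun (P'.map U') t)‖ := by congr 1; ring
    _ ≤ _ := (norm_sub_le _ _).trans (add_le_add_left (norm_add_le _ _) _)
    _ < δ := by linarith

/-- Changing the limiting random variable without changing its law. -/
theorem tendstoInDistribution_of_map_eq {Ω'' : Type*} {mΩ'' : MeasurableSpace Ω''}
    {P'' : Measure Ω''} [IsProbabilityMeasure P''] {E : Type*} [TopologicalSpace E]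
    [MeasurableSpace E] [OpensMeasurableSpace E] {V : ℕ → Ω → E} {V' : Ω' → E} {V'' : Ω'' → E}
    (h : TendstoInDistribution V atTop V' (fun _ => P) P') (hV'' : AEMeasurable V'' P'')
    (hlaw : P'.map V' = P''.map V'') :
    TendstoInDistribution V atTop V'' (fun _ => P) P'' := by
  refine ⟨h.forall_aemeasurable, hV'', ?_⟩
  rw! [← hlaw]
  exact h.tendsto

/-- The truncation error vanishes where |W| ≤ M, and elsewhere it is at most |W| ≤ W²/M. -/
theorem abs_integral_sub_integral_truncation_le {W : Ω → ℝ} {D M : ℝ} (hW : MemLp W 2 P)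
    (hD : ∫ ω, W ω ^ 2 ∂P ≤ D) (hM : 0 < M) :
    |∫ ω, W ω ∂P - ∫ ω, max (-M) (min (W ω) M) ∂P| ≤ D / M := by
  have hmeas : AEMeasurable W P := hW.aestronglyMeasurable.aemeasurable
  have hintg : Integrable (fun ω => max (-M) (min (W ω) M)) P := by
    refine Integrable.of_bound (C := M)
      (by fun_prop) (ae_of_all _ fun ω => ?_)
    rw [Real.norm_eq_abs, abs_le]
    exact ⟨le_max_left _ _, max_le (by linarith) (min_le_right _ _)⟩
  rw [← integral_sub (hW.integrable (by norm_num)) hintg]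
  have := norm_integral_le_of_norm_le (μ := P) (f := fun ω => W ω - max (-M) (min (W ω) M))
    (g := fun ω => W ω ^ 2 / M) (hW.integrable_sq.div_const _) (ae_of_all _ fun ω => ?_)
  · rw [integral_div] at this
    exact this.trans (by gcongr)
  · rw [Real.norm_eq_abs, le_div_iff₀ hM]
    rcases le_total (W ω) M with h1 | h1 <;> rcases le_total (-M) (W ω) with h2 | h2
    · rw [min_eq_left h1, max_eq_right h2]; simp; positivity
    · rw [min_eq_left h1, max_eq_left h2, abs_of_nonpos (by linarith)]; nlinarith
    · rw [min_eq_right h1, max_eq_right (by linarith), abs_of_nonneg (by linarith)]; nlinarith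
    · linarith

/-- Convergence in distribution and boundedness in `L²` imply convergence of the means. -/
theorem tendsto_integral_of_tendstoInDistribution {V : ℕ → Ω → ℝ} {V' : Ω' → ℝ}
    (h : TendstoInDistribution V atTop V' (fun _ => P) P') {C : ℝ}
    (hC : ∀ n, eLpNorm (V n) 2 P ≤ ENNReal.ofReal C) (hC' : MemLp V' 2 P') :
    Tendsto (fun n => ∫ ω, V n ω ∂P) atTop (𝓝 (∫ ω, V' ω ∂P')) := by
  have sq : ∀ n, MemLp (V n) 2 P ∧ ∫ ω, V n ω ^ 2 ∂P ≤ (max C 0) ^ 2 := by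
    intro n
    have hm : MemLp (V n) 2 P := ⟨(h.forall_aemeasurable n).aestronglyMeasurable,
      (hC n).trans_lt ENNReal.ofReal_lt_top⟩
    refine ⟨hm, ?_⟩
    have h1 := eLpNorm_sq (μ := P) (V n) 1
    rw [mul_one, eLpNorm_one_eq_lintegral_enorm,
      ← ofReal_integral_norm_eq_lintegral_enorm hm.integrable_sq] at h1
    have h2 : ENNReal.ofReal (∫ ω, ‖V n ω ^ 2‖ ∂P) ≤ ENNReal.ofReal ((max C 0) ^ 2) := by
      rw [h1, ENNReal.ofReal_pow (le_max_right _ _)]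
      gcongr
      exact (hC n).trans (ENNReal.ofReal_le_ofReal (le_max_left _ _))
    rw [ENNReal.ofReal_le_ofReal_iff (by positivity)] at h2
    simpa using h2
  set D : ℝ := max ((max C 0) ^ 2) (∫ ω, V' ω ^ 2 ∂P') with hD
  have hD0 : 0 ≤ D := le_max_of_le_left (by positivity)
  rw [Metric.tendsto_atTop]
  intro ε hε
  -- `D` bounds all the second moments, including that of the limit, so truncation at `M` moves
  -- every mean by at most ε/4. The truncation is a bounded continuous test function.
  set M : ℝ := 4 * (D + 1) / ε with hM
  have hM0 : 0 < M := by positivity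
  have hDM : D / M ≤ ε / 4 := by
    rw [hM, div_div_eq_mul_div, div_le_div_iff₀ (by positivity) (by norm_num)]
    nlinarith
  let g : BoundedContinuousFunction ℝ ℝ := BoundedContinuousFunction.ofNormedAddCommGroup
    (fun x => max (-M) (min x M)) (by fun_prop) M (fun x => by
      rw [Real.norm_eq_abs, abs_le]
      exact ⟨le_max_left _ _, max_le (by linarith) (min_le_right _ _)⟩)
  have hg := (ProbabilityMeasure.tendsto_iff_forall_integral_tendsto.1 h.tendsto) g
  simp only [ProbabilityMeasure.coe_mk] at hg
  have e1 : ∀ n, ∫ x, g x ∂(P.map (V n)) = ∫ ω, max (-M) (min (V n ω) M) ∂P := fun n =>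
    integral_map (h.forall_aemeasurable n) g.continuous.aestronglyMeasurable
  have e2 : ∫ x, g x ∂(P'.map V') = ∫ ω, max (-M) (min (V' ω) M) ∂P' :=
    integral_map h.aemeasurable_limit g.continuous.aestronglyMeasurable
  simp only [e1, e2] at hg
  obtain ⟨N, hN⟩ := Metric.tendsto_atTop.1 hg (ε / 4) (by positivity)
  refine ⟨N, fun n hn => ?_⟩
  have a1 := (abs_integral_sub_integral_truncation_le (sq n).1
    ((sq n).2.trans (le_max_left _ _)) hM0).trans hDM
  have a2 := (abs_integral_sub_integral_truncation_le hC' (le_max_right _ _) hM0).trans hDM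
  have a3 := hN n hn
  rw [Real.dist_eq] at a3 ⊢
  rw [abs_le] at a1 a2
  rw [abs_lt] at a3 ⊢
  constructor <;> linarith [a1.1, a1.2, a2.1, a2.2, a3.1, a3.2]

end ConvergenceInDistribution

/-! ### Normalized sums: moment bounds and central limit theorem. -/

/-- A family of measurable functions, bounded by `B`, that together with the constant function `1`
is orthonormal in `L²(μ)`. -/
structure IsBoundedOrthonormal {S ι : Type*} [MeasurableSpace S] [DecidableEq ι] (μ : Measure S)
    (e : ι → S → ℝ) (B : ℝ) : Prop where
  measurable : ∀ m, Measurable (e m)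
  abs_le : ∀ m x, |e m x| ≤ B
  integral_eq_zero : ∀ m, ∫ x, e m x ∂μ = 0
  integral_mul : ∀ m l, ∫ x, e m x * e l x ∂μ = if m = l then 1 else 0

/-- The normalized sum `(f (x 0) + ⋯ + f (x (n-1))) / √n`. -/
noncomputable def normalizedSum {S : Type*} (f : S → ℝ) (n : ℕ) (x : ℕ → S) : ℝ :=
  (√n)⁻¹ * ∑ i ∈ Finset.range n, f (x i)

section Sample

variable {S Ω : Type*} [MeasurableSpace S] {mΩ : MeasurableSpace Ω} {μ : Measure S}
  {P : Measure Ω} {X : ℕ → Ω → S}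

theorem aemeasurable_normalizedSum (hX : ∀ i, HasLaw (X i) μ P) {f : S → ℝ} (hf : Measurable f)
    (n : ℕ) : AEMeasurable (fun ω => normalizedSum f n (X · ω)) P :=
  (Finset.aemeasurable_fun_sum _ fun i _ =>
    hf.comp_aemeasurable (hX i).aemeasurable).const_mul _

/-- One term of the exponential series, with 40320 = 8!. It turns a bound on the moment generating
function at ±1 into a bound on the eighth moment. -/
theorem pow_eight_le (x : ℝ) : x ^ 8 ≤ 40320 * (Real.exp x + Real.exp (-x)) := by
  have h : |x| ^ 8 / (Nat.factorial 8 : ℝ) ≤ Real.exp |x| :=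
    Real.pow_div_factorial_le_exp _ (abs_nonneg x) 8
  have h8 : (Nat.factorial 8 : ℝ) = 40320 := by norm_num [Nat.factorial]
  rw [h8, div_le_iff₀ (by norm_num), show |x| ^ 8 = x ^ 8 from Even.pow_abs (by decide) x] at h
  rcases abs_cases x with ⟨hx, -⟩ | ⟨hx, -⟩ <;> rw [hx] at h <;>
    nlinarith [Real.exp_pos x, Real.exp_pos (-x)]

/-- Normalized sums of a bounded centered function are bounded in `L⁸`. -/
theorem eLpNorm_normalizedSum_le [IsProbabilityMeasure P] (hind : iIndepFun X P)
    (hX : ∀ i, HasLaw (X i) μ P) {f : S → ℝ}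
    (hf : Measurable f) {B : ℝ} (hB : ∀ x, |f x| ≤ B) (h0 : ∫ x, f x ∂μ = 0) (n : ℕ) :
    eLpNorm (fun ω => normalizedSum f n (X · ω)) 8 P
      ≤ ENNReal.ofReal (80640 * Real.exp (B ^ 2 / 2)) ^ (1 / 8 : ℝ) := by
  have hmeas := aemeasurable_normalizedSum hX hf n
  -- Hoeffding's lemma on [-B, B]: the variance proxy is B². The sum has proxy nB², which the factor
  -- 1/√n brings back to B², uniformly in `n`.
  have hsub : ∀ i, HasSubgaussianMGF (fun ω => f (X i ω)) ((‖B - -B‖₊ / 2) ^ 2) P := fun i =>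
    hasSubgaussianMGF_of_mem_Icc_of_integral_eq_zero (hf.comp_aemeasurable (hX i).aemeasurable)
      (ae_of_all _ fun ω => abs_le.1 (hB _))
      (((hX i).integral_comp hf.aestronglyMeasurable).trans h0)
  have hsum := HasSubgaussianMGF.sum_of_iIndepFun (s := Finset.range n)
    (hind.comp (fun _ => f) fun _ => hf) (fun i _ => hsub i)
  have hvar : ((∑ _i ∈ Finset.range n, (‖B - -B‖₊ / 2) ^ 2 : NNReal) : ℝ) = n * B ^ 2 := by
    simp only [Finset.sum_const, Finset.card_range, nsmul_eq_mul, NNReal.coe_mul, NNReal.coe_pow,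
      NNReal.coe_div, coe_nnnorm, Real.norm_eq_abs, NNReal.coe_natCast, NNReal.coe_ofNat, div_pow,
      sq_abs]
    ring
  have hexp : ∀ s : ℝ, s ^ 2 = 1 →
      Integrable (fun ω => Real.exp (s * normalizedSum f n (X · ω))) P ∧
      ∫ ω, Real.exp (s * normalizedSum f n (X · ω)) ∂P ≤ Real.exp (B ^ 2 / 2) := by
    intro s hs
    have h1 := hsum.integrable_exp_mul (s * (√n)⁻¹)
    have h2 := hsum.mgf_le (s * (√n)⁻¹)
    simp only [mgf, mul_assoc, Function.comp_apply] at h1 h2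
    refine ⟨h1, h2.trans (Real.exp_le_exp.2 ?_)⟩
    rw [hvar, mul_pow, hs, one_mul, inv_pow, Real.sq_sqrt (Nat.cast_nonneg n)]
    rcases eq_or_ne n 0 with rfl | hn
    · simp; positivity
    · have : (n : ℝ) ≠ 0 := by exact_mod_cast hn
      field_simp
      rfl
  obtain ⟨i1, b1⟩ := hexp 1 (by norm_num)
  obtain ⟨i2, b2⟩ := hexp (-1) (by norm_num)
  simp only [one_mul, neg_one_mul] at i1 i2 b1 b2
  have hlin : ∫⁻ ω, ‖normalizedSum f n (X · ω)‖ₑ ^ (8 : ℝ) ∂P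
      ≤ ENNReal.ofReal (80640 * Real.exp (B ^ 2 / 2)) := by
    calc _ ≤ ∫⁻ ω, ENNReal.ofReal (40320 * (Real.exp (normalizedSum f n (X · ω))
            + Real.exp (-normalizedSum f n (X · ω)))) ∂P := by
          refine lintegral_mono fun ω => ?_
          simp only [ENNReal.rpow_ofNat]
          rw [← enorm_pow, Real.enorm_of_nonneg (by positivity)]
          exact ENNReal.ofReal_le_ofReal (pow_eight_le _)
      _ = ENNReal.ofReal (∫ ω, 40320 * (Real.exp (normalizedSum f n (X · ω))
            + Real.exp (-normalizedSum f n (X · ω))) ∂P) := by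
          exact (ofReal_integral_eq_lintegral_ofReal ((i1.add i2).const_mul _)
            (ae_of_all _ fun ω => by simp only [Pi.add_apply, Pi.zero_apply]; positivity)).symm
      _ ≤ _ := by
          refine ENNReal.ofReal_le_ofReal ?_
          rw [integral_const_mul, integral_add i1 i2]
          linarith
  rw [eLpNorm_eq_lintegral_rpow_enorm_toReal (by norm_num) (by norm_num)]
  simp only [ENNReal.toReal_ofNat]
  gcongr

/-- The multivariate central limit theorem for a bounded orthonormal family. -/
theorem tendstoInDistribution_normalizedSum [IsProbabilityMeasure μ] [IsProbabilityMeasure P]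
    {ι : Type*} [DecidableEq ι] {e : ι → S → ℝ} {B : ℝ}
    (he : IsBoundedOrthonormal μ e B) (hind : iIndepFun X P) (hX : ∀ i, HasLaw (X i) μ P)
    (F : Finset ι) :
    TendstoInDistribution
      (fun n ω => WithLp.toLp 2 (fun m : F => normalizedSum (e m) n (X · ω))) atTop
      (fun ξ : ι → ℝ => WithLp.toLp 2 (F.restrict ξ)) (fun _ => P)
      (Measure.infinitePi fun _ => gaussianReal 0 1) := by
  have hZ : ∀ n, AEMeasurable
      (fun ω => WithLp.toLp 2 (fun m : F => normalizedSum (e m) n (X · ω))) P := fun n =>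
    (WithLp.measurable_toLp 2 _).comp_aemeasurable
      (aemeasurable_pi_lambda _ fun m => aemeasurable_normalizedSum hX (he.measurable m) n)
  have hlim : (Measure.infinitePi fun _ : ι => gaussianReal 0 1).map
      (fun ξ : ι → ℝ => WithLp.toLp 2 (F.restrict ξ)) = stdGaussian (EuclideanSpace ℝ F) := by
    rw [← map_pi_eq_stdGaussian, ← Measure.infinitePi_map_restrict (fun _ : ι => gaussianReal 0 1),
      Measure.map_map (by fun_prop) (by fun_prop)]
    rfl
  refine ⟨hZ, by fun_prop, ?_⟩
  refine ProbabilityMeasure.tendsto_iff_tendsto_charFun.2 fun t => ?_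
  rw! [hlim]
  simp only [ProbabilityMeasure.coe_mk]
  rw [charFun_stdGaussian]
  -- Cramér–Wold: the characteristic function at `t` of the vector is the one at 1 of the normalized
  -- sum of `u`, and orthonormality gives `u` the variance ‖t‖².
  obtain ⟨u, hu⟩ : ∃ u : S → ℝ, u = fun x => ∑ m : F, t m * e m x := ⟨_, rfl⟩
  have hum : Measurable u := by
    rw [hu]
    exact Finset.measurable_sum _ fun m _ => (he.measurable m).const_mul _
  have heint : ∀ m, Integrable (e m) μ := fun m =>
    Integrable.of_bound (he.measurable m).aestronglyMeasurable B (ae_of_all _ (he.abs_le m))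
  have heeint : ∀ m l, Integrable (fun x => e m x * e l x) μ := fun m l =>
    (heint m).mul_bdd (he.measurable l).aestronglyMeasurable (ae_of_all _ (he.abs_le l))
  have hu0 : ∫ x, u x ∂μ = 0 := by
    rw [hu, integral_finsetSum _ fun (m : F) _ => (heint m).const_mul _]
    simp [integral_const_mul, he.integral_eq_zero]
  have hu2 : ∫ x, u x ^ 2 ∂μ = ‖t‖ ^ 2 := by
    have : ∀ x, u x ^ 2 = ∑ m : F, ∑ l : F, (t m * t l) * (e m x * e l x) := fun x => by
      rw [hu, sq, Finset.sum_mul_sum]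
      exact Finset.sum_congr rfl fun m _ => Finset.sum_congr rfl fun l _ => by ring
    simp only [this]
    rw [integral_finsetSum _ fun (m : F) _ => integrable_finsetSum _ fun (l : F) _ =>
      (heeint m l).const_mul _]
    simp only [integral_finsetSum _ fun (l : F) _ => (heeint _ l).const_mul _, integral_const_mul,
      he.integral_mul, Subtype.coe_inj]
    rw [EuclideanSpace.real_norm_sq_eq]
    simp [sq]
  have hu_memLp : MemLp u 2 μ := by
    refine MemLp.of_bound hum.aestronglyMeasurable (∑ m, |t m| * B) (ae_of_all _ fun x => ?_)
    rw [hu]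
    refine (norm_sum_le _ _).trans (Finset.sum_le_sum fun m _ => ?_)
    rw [norm_mul]
    exact mul_le_mul_of_nonneg_left (he.abs_le m x) (abs_nonneg _)
  have hmean : ∫ ω, u (X 0 ω) ∂P = 0 :=
    ((hX 0).integral_comp hum.aestronglyMeasurable).trans hu0
  have hvar : Var[fun ω => u (X 0 ω); P] = ‖t‖ ^ 2 := by
    rw [variance_of_integral_eq_zero (X := fun ω => u (X 0 ω))
      (hum.comp_aemeasurable (hX 0).aemeasurable) hmean, ← hu2]
    exact (hX 0).integral_comp (f := fun x => u x ^ 2) (by fun_prop)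
  have hY : HasLaw (id : ℝ → ℝ)
      (gaussianReal 0 (Var[fun ω => u (X 0 ω); P]).toNNReal)
      (gaussianReal 0 (Var[fun ω => u (X 0 ω); P]).toNNReal) := HasLaw.id
  have hclt := tendstoInDistribution_inv_sqrt_mul_sum_sub (X := fun i ω => u (X i ω)) hY
    (by
      have := hu_memLp
      rw [← (hX 0).map_eq] at this
      exact this.comp_of_map (hX 0).aemeasurable)
    (hind.comp (fun _ => u) fun _ => hum)
    (fun i => (IdentDistrib.mk (hX i).aemeasurable (hX 0).aemeasurable
      ((hX i).map_eq.trans (hX 0).map_eq.symm)).comp hum)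
  have hchar := ProbabilityMeasure.tendsto_iff_tendsto_charFun.1 hclt.tendsto 1
  simp only [ProbabilityMeasure.coe_mk, Measure.map_id, charFun_gaussianReal, hmean, hvar] at hchar
  convert hchar using 2 with n
  · rw [charFun_apply, charFun_apply_real, integral_map (hZ n) (by fun_prop),
      integral_map (by
        simpa only [mul_zero, sub_zero, normalizedSum] using aemeasurable_normalizedSum hX hum n) (by fun_prop)]
    congr 1
    ext ω
    congr 2
    simp only [PiLp.inner_apply, normalizedSum, hu, mul_zero, sub_zero, Complex.ofReal_one, one_mul,
      RCLike.inner_apply, conj_trivial]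
    congr 1
    rw [Finset.sum_comm, Finset.mul_sum]
    refine Finset.sum_congr rfl fun m _ => ?_
    rw [← Finset.mul_sum]
    ring
  · rw [Real.coe_toNNReal _ (by positivity)]
    push_cast
    ring_nf

end Sample

/-! ### Kernel statistics and the pointwise cost of truncating the kernel. -/

/-- The integral `∫ (∫ k(y, z) dλ(z))² dλ(y)`, where `λ` is the empirical measure of
`x 0, …, x (n-1)`. -/
noncomputable def kernelStatistic {S : Type*} (k : S → S → ℝ) (n : ℕ) (x : ℕ → S) : ℝ :=
  (n : ℝ)⁻¹ * ∑ j ∈ Finset.range n, ((n : ℝ)⁻¹ * ∑ i ∈ Finset.range n, k (x j) (x i)) ^ 2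

/-- The fluctuation `n (Φ_n - d₀²)` of the kernel statistic, for the kernel truncated to
`d₀ + ∑_{m ∈ F} a_m e_m(x) e_m(y)`. -/
noncomputable def truncatedFluctuation {S ι : Type*} (d₀ : ℝ) (a : ι → ℝ) (e : ι → S → ℝ)
    (F : Finset ι) (n : ℕ) (x : ℕ → S) : ℝ :=
  2 * d₀ * ∑ m ∈ F, a m * normalizedSum (e m) n x ^ 2
    + (n : ℝ)⁻¹ * ∑ j ∈ Finset.range n, (∑ m ∈ F, a m * e m (x j) * normalizedSum (e m) n x) ^ 2

theorem HasSum.abs_sub_sum_le {ι : Type*} [DecidableEq ι] {f g : ι → ℝ} {s : ℝ} (hf : HasSum f s)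
    (hg : Summable g) (hfg : ∀ m, |f m| ≤ g m) (F : Finset ι) :
    |s - ∑ m ∈ F, f m| ≤ ∑' m, if m ∈ F then 0 else g m := by
  have h1 : HasSum (fun m => f m - if m ∈ F then f m else 0) (s - ∑ m ∈ F, f m) := by
    refine hf.sub ?_
    have : HasSum (fun m => if m ∈ F then f m else 0) (∑ m ∈ F, if m ∈ F then f m else 0) :=
      hasSum_sum_of_ne_finset_zero fun m hm => if_neg hm
    rwa [Finset.sum_congr rfl fun m hm => if_pos hm] at this
  have h2 : Summable fun m => if m ∈ F then 0 else g m := by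
    refine hg.of_nonneg_of_le (fun m => ?_) (fun m => ?_) <;> split_ifs
    · exact le_rfl
    · exact (abs_nonneg _).trans (hfg m)
    · exact (abs_nonneg _).trans (hfg m)
    · exact le_rfl
  refine h1.norm_le_of_bounded h2.hasSum fun m => ?_
  split_ifs <;> simp [hfg m]

section Pointwise

variable {S ι : Type*} {k : S → S → ℝ} {d₀ B : ℝ} {a : ι → ℝ} {e : ι → S → ℝ}

theorem abs_normalizedSum_le {f : S → ℝ} (hB : ∀ x, |f x| ≤ B) (n : ℕ) (x : ℕ → S) :
    |normalizedSum f n x| ≤ √n * B := by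
  rw [normalizedSum, abs_mul, abs_of_nonneg (by positivity)]
  calc (√n)⁻¹ * |∑ i ∈ Finset.range n, f (x i)| ≤ (√n)⁻¹ * (n * B) := by
        gcongr
        refine (Finset.abs_sum_le_sum_abs _ _).trans ?_
        refine (Finset.sum_le_sum fun i _ => hB (x i)).trans ?_
        simp
    _ = √n * B := by
        rcases eq_or_ne n 0 with rfl | hn
        · simp
        have : √(n : ℝ) ≠ 0 := by positivity
        field_simp
        rw [Real.sq_sqrt (by positivity)]

/-- The crude bound √n B only secures convergence of the series for fixed `n`; uniformity in `n`
comes from the L⁸ bounds. -/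
theorem summable_abs_mul_normalizedSum_pow (he : ∀ m x, |e m x| ≤ B)
    (ha : Summable fun m => |a m|) (n : ℕ) (x : ℕ → S) (r : ℕ) :
    Summable fun m => |a m| * |normalizedSum (e m) n x| ^ r := by
  refine (ha.mul_right ((√n * B) ^ r)).of_nonneg_of_le (fun m => by positivity) fun m => ?_
  gcongr
  exact abs_normalizedSum_le (he m) n x

/-- Squaring d₀ + n^(-1/2) G_j and averaging over j leaves a term linear in G, which is exactly 2d₀
∑ a_m z_m², and the average of G_j². Truncation costs a tail in the first. In the second, a
difference of squares is a difference of size at most B W' times a sum of size at most 2 B W, where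
W' is the tail of W = ∑ |a_m| |z_m|. -/
theorem abs_fluctuation_sub_truncatedFluctuation_le [DecidableEq ι] (hB : 0 ≤ B)
    (hk : ∀ x y, HasSum (fun m => a m * (e m x * e m y)) (k x y - d₀))
    (he : ∀ m x, |e m x| ≤ B) (ha : Summable fun m => |a m|) (F : Finset ι) (n : ℕ) (x : ℕ → S) :
    |n * (kernelStatistic k n x - d₀ ^ 2) - truncatedFluctuation d₀ a e F n x|
      ≤ 2 * |d₀| * (∑' m, (if m ∈ F then 0 else |a m|) * normalizedSum (e m) n x ^ 2)
        + 2 * B ^ 2 * ((∑' m, (if m ∈ F then 0 else |a m|) * |normalizedSum (e m) n x|)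
          * ∑' m, |a m| * |normalizedSum (e m) n x|) := by
  have hnn : ∀ m, 0 ≤ (if m ∈ F then 0 else |a m|) := fun m => by split_ifs <;> positivity
  rcases eq_or_ne n 0 with rfl | hn
  · simp [truncatedFluctuation, normalizedSum]
  have hn1 : (n : ℝ) ≠ 0 := by positivity
  have hninv : (√(n : ℝ))⁻¹ ^ 2 = (n : ℝ)⁻¹ := by rw [inv_pow, Real.sq_sqrt (by positivity)]
  set z : ι → ℝ := fun m => normalizedSum (e m) n x with hz
  set G : ℕ → ℝ := fun j => (√n)⁻¹ * ∑ i ∈ Finset.range n, (k (x j) (x i) - d₀) with hG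
  have hGsum : ∀ j, HasSum (fun m => a m * e m (x j) * z m) (G j) := fun j => by
    have := (hasSum_sum (s := Finset.range n) fun i _ => hk (x j) (x i)).mul_left (√n)⁻¹
    convert! this using 2 with m
    simp only [hz, normalizedSum, Finset.mul_sum]
    exact Finset.sum_congr rfl fun i _ => by ring
  have hTsum : HasSum (fun m => a m * z m ^ 2) ((√n)⁻¹ * ∑ j ∈ Finset.range n, G j) := by
    have := (hasSum_sum (s := Finset.range n) fun j _ => hGsum j).mul_left (√n)⁻¹
    convert! this using 2 with m
    rw [← Finset.sum_mul, ← Finset.mul_sum]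
    simp only [hz, normalizedSum]
    ring
  have hexpand : n * (kernelStatistic k n x - d₀ ^ 2)
      = 2 * d₀ * ((√n)⁻¹ * ∑ j ∈ Finset.range n, G j)
        + (n : ℝ)⁻¹ * ∑ j ∈ Finset.range n, G j ^ 2 := by
    have h1 : ∀ j, (n : ℝ)⁻¹ * ∑ i ∈ Finset.range n, k (x j) (x i) = d₀ + (√n)⁻¹ * G j := fun j => by
      simp only [hG, Finset.sum_sub_distrib, Finset.sum_const, Finset.card_range, nsmul_eq_mul]
      rw [← mul_assoc, ← sq, hninv, mul_sub, inv_mul_cancel_left₀ hn1]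
      ring
    simp only [kernelStatistic, h1]
    have h2 : ∀ j, (d₀ + (√n)⁻¹ * G j) ^ 2
        = d₀ ^ 2 + 2 * d₀ * (√n)⁻¹ * G j + (n : ℝ)⁻¹ * G j ^ 2 := fun j => by
      rw [← hninv]
      ring
    simp only [h2, Finset.sum_add_distrib, ← Finset.mul_sum, Finset.sum_const, Finset.card_range,
      nsmul_eq_mul]
    field_simp
    ring
  have hs1 : Summable fun m => |a m| * |z m| := by
    simpa using summable_abs_mul_normalizedSum_pow he ha n x 1
  have hs2 : Summable fun m => |a m| * z m ^ 2 := by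
    simpa only [sq_abs] using summable_abs_mul_normalizedSum_pow he ha n x 2
  set W : ℝ := ∑' m, |a m| * |z m|
  set W' : ℝ := ∑' m, (if m ∈ F then 0 else |a m|) * |z m|
  have hW' : 0 ≤ W' := tsum_nonneg fun m => mul_nonneg (hnn m) (abs_nonneg _)
  have hterm : ∀ m y, |a m * e m y * z m| ≤ B * (|a m| * |z m|) := fun m y => by
    rw [abs_mul, abs_mul]
    nlinarith [mul_le_mul_of_nonneg_left (he m y) (mul_nonneg (abs_nonneg (a m)) (abs_nonneg (z m)))]
  have hT := hTsum.abs_sub_sum_le hs2 (fun m => by rw [abs_mul, abs_of_nonneg (sq_nonneg (z m))]) F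
  have hGd : ∀ j, |G j - ∑ m ∈ F, a m * e m (x j) * z m| ≤ B * W' := fun j => by
    have h1 := (hGsum j).abs_sub_sum_le (hs1.mul_left B) (fun m => hterm m (x j)) F
    refine h1.trans (le_of_eq ?_)
    rw [← tsum_mul_left]
    exact tsum_congr fun m => by split_ifs <;> simp
  have hG1 : ∀ j, |G j| ≤ B * W := fun j => by
    have h1 := (hGsum j).abs_sub_sum_le (hs1.mul_left B) (fun m => hterm m (x j)) ∅
    simpa [tsum_mul_left] using h1
  have hG2 : ∀ j, |∑ m ∈ F, a m * e m (x j) * z m| ≤ B * W := fun j => by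
    refine (Finset.abs_sum_le_sum_abs _ _).trans ?_
    refine (Finset.sum_le_sum fun m _ => hterm m (x j)).trans ?_
    rw [← tsum_mul_left]
    exact (hs1.mul_left B).sum_le_tsum F fun m _ => by positivity
  have hsq : ∀ j, |G j ^ 2 - (∑ m ∈ F, a m * e m (x j) * z m) ^ 2| ≤ 2 * B ^ 2 * (W' * W) :=
    fun j => by
    rw [sq_sub_sq, abs_mul]
    have h1 : |G j + ∑ m ∈ F, a m * e m (x j) * z m| ≤ 2 * (B * W) :=
      (abs_add_le _ _).trans (by linarith [hG1 j, hG2 j])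
    calc _ ≤ 2 * (B * W) * (B * W') := by
          gcongr
          exact hGd j
      _ = _ := by ring
  have hfin : |(n : ℝ)⁻¹ * ∑ j ∈ Finset.range n, G j ^ 2
      - (n : ℝ)⁻¹ * ∑ j ∈ Finset.range n, (∑ m ∈ F, a m * e m (x j) * z m) ^ 2|
      ≤ 2 * B ^ 2 * (W' * W) := by
    rw [← mul_sub, ← Finset.sum_sub_distrib, abs_mul, abs_of_nonneg (by positivity),
      inv_mul_le_iff₀ (by positivity)]
    refine (Finset.abs_sum_le_sum_abs _ _).trans ?_
    refine (Finset.sum_le_sum fun j _ => hsq j).trans ?_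
    simp
  rw [hexpand, truncatedFluctuation]
  calc _ = |2 * d₀ * ((√n)⁻¹ * ∑ j ∈ Finset.range n, G j - ∑ m ∈ F, a m * z m ^ 2)
        + ((n : ℝ)⁻¹ * ∑ j ∈ Finset.range n, G j ^ 2
      - (n : ℝ)⁻¹ * ∑ j ∈ Finset.range n, (∑ m ∈ F, a m * e m (x j) * z m) ^ 2)| := by
        congr 1; ring
    _ ≤ _ := abs_add_le _ _
    _ ≤ _ := by
        refine add_le_add ?_ hfin
        rw [abs_mul, abs_mul, abs_two]
        gcongr
        refine hT.trans (le_of_eq (tsum_congr fun m => ?_))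
        split_ifs <;> simp [hz]

end Pointwise

/-! ### Weighted chi-squared sums of independent Gaussians. -/

/-- The weighted chi-squared sum `∑ c_m ξ_m²`. -/
noncomputable def weightedChiSq {ι : Type*} (c : ι → ℝ) (ξ : ι → ℝ) : ℝ := ∑' m, c m * ξ m ^ 2

/-- The law of a family of independent standard Gaussian variables indexed by `ι`. -/
noncomputable abbrev gaussianFamily (ι : Type*) : Measure (ι → ℝ) :=
  Measure.infinitePi fun _ => gaussianReal 0 1

theorem eLpNorm_eval_gaussianFamily {ι : Type*} (m : ι) (p : ℝ≥0∞) :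
    eLpNorm (fun ξ : ι → ℝ => ξ m) p (gaussianFamily ι) = eLpNorm id p (gaussianReal 0 1) := by
  have h := measurePreserving_eval_infinitePi (fun _ : ι => gaussianReal 0 1) m
  have h2 := eLpNorm_comp_measurePreserving (p := p) (g := (id : ℝ → ℝ))
    measurable_id.aestronglyMeasurable h
  rw [← h2]
  rfl

theorem exists_eLpNorm_sq_eval_gaussianFamily_le (ι : Type*) (p : NNReal) :
    ∃ K : ℝ≥0∞, K ≠ ∞ ∧ ∀ m, eLpNorm (fun ξ : ι → ℝ => ξ m ^ 2) p (gaussianFamily ι) ≤ K := by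
  refine ⟨eLpNorm id (2 * p) (gaussianReal 0 1) ^ 2, ?_, fun m => ?_⟩
  · exact ENNReal.pow_ne_top (memLp_id_gaussianReal' (2 * p) (by finiteness)).2.ne
  · rw [eLpNorm_sq, eLpNorm_eval_gaussianFamily]

theorem tendsto_tsum_enorm_compl {ι : Type*} [DecidableEq ι] {a : ι → ℝ}
    (ha : Summable fun m => |a m|) :
    Tendsto (fun F : Finset ι => ∑' m, ‖if m ∈ F then 0 else |a m|‖ₑ) atTop (𝓝 0) := by
  have hA : ∑' m, ‖a m‖ₑ ≠ ∞ := tsum_enorm_ne_top_iff_summable_norm.2 ha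
  convert ENNReal.tendsto_tsum_compl_atTop_zero hA using 2 with F
  refine Eq.trans ?_ (tsum_subtype {x | x ∉ F} fun m => ‖a m‖ₑ).symm
  refine tsum_congr fun m => ?_
  by_cases hm : m ∈ F <;> simp [hm]

theorem ae_summable_abs_mul_sq {ι : Type*} [Countable ι] {c : ι → ℝ}
    (hc : Summable fun m => |c m|) :
    ∀ᵐ ξ ∂(gaussianFamily ι), Summable fun m => |c m| * ξ m ^ 2 := by
  obtain ⟨K, hK, h⟩ := exists_eLpNorm_sq_eval_gaussianFamily_le ι 1
  have := summable_norm_of_tsum_eLpNorm_ne_top (μ := gaussianFamily ι) (p := 1) le_rfl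
    (f := fun m ξ => |c m| * ξ m ^ 2)
    (fun m => (((measurable_pi_apply m).pow_const 2).const_mul _).aestronglyMeasurable) ?_
  · filter_upwards [this] with ξ hξ
    simpa using hξ
  · refine ne_top_of_le_ne_top (b := (∑' m, ‖c m‖ₑ) * K)
      (ENNReal.mul_ne_top (tsum_enorm_ne_top_iff_summable_norm.2 hc) hK) ?_
    rw [← ENNReal.tsum_mul_right]
    refine ENNReal.tsum_le_tsum fun m => (eLpNorm_const_mul_le _ _ _).trans ?_
    rw [← Real.norm_eq_abs, enorm_norm]
    gcongr
    exact h m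

/-- All the ξ_m² have the same L^p norm, so Minkowski's inequality gives a constant that depends on
`p` alone. -/
theorem eLpNorm_weightedChiSq_sub_sum_le {ι : Type*} [Countable ι] [DecidableEq ι] {p : NNReal}
    (hp : 1 ≤ p) :
    ∃ K : ℝ≥0∞, K ≠ ∞ ∧ ∀ (c : ι → ℝ), (Summable fun m => |c m|) → ∀ F : Finset ι,
      eLpNorm (fun ξ : ι → ℝ => weightedChiSq c ξ - ∑ m ∈ F, c m * ξ m ^ 2) p (gaussianFamily ι)
        ≤ K * ∑' m, ‖if m ∈ F then 0 else |c m|‖ₑ := by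
  obtain ⟨K, hK, h⟩ := exists_eLpNorm_sq_eval_gaussianFamily_le ι p
  refine ⟨K, hK, fun c hc F => ?_⟩
  have hp' : (1 : ℝ≥0∞) ≤ p := by exact_mod_cast hp
  have h0 := eLpNorm_tsum_mul_le hp'
    (fun m => ((measurable_pi_apply m).pow_const 2).aestronglyMeasurable) h
    (fun m => if m ∈ F then 0 else |c m|)
  rw [mul_comm K]
  refine le_trans (eLpNorm_mono_ae_real ?_) h0
  filter_upwards [ae_summable_abs_mul_sq hc] with ξ hξ
  have habs : ∀ m, |c m * ξ m ^ 2| ≤ |c m| * ξ m ^ 2 := fun m => by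
    rw [abs_mul, abs_of_nonneg (sq_nonneg (ξ m))]
  have h1 := (hξ.of_norm_bounded habs).hasSum.abs_sub_sum_le hξ habs F
  simpa only [ite_mul, zero_mul, Real.norm_eq_abs, weightedChiSq] using h1

theorem measurable_weightedChiSq {ι : Type*} [Countable ι] (c : ι → ℝ) :
    Measurable (weightedChiSq c) :=
  Measurable.tsum fun m => by fun_prop

/-- The squares are summable since |a_m|² ≤ |a_m| ∑ |a_l|. -/
theorem summable_abs_quadratic {ι : Type*} {a : ι → ℝ} (d₀ : ℝ) (ha : Summable fun m => |a m|) :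
    Summable fun m => |2 * d₀ * a m + a m ^ 2| := by
  refine (ha.mul_left (2 * |d₀| + ∑' m, |a m|)).of_nonneg_of_le (fun m => abs_nonneg _) fun m => ?_
  have h1 : |a m| ≤ ∑' m, |a m| := ha.le_tsum m fun _ _ => abs_nonneg _
  calc _ ≤ |2 * d₀ * a m| + |a m ^ 2| := abs_add_le _ _
    _ = 2 * |d₀| * |a m| + |a m| * |a m| := by rw [abs_mul, abs_mul, abs_two, sq, abs_mul]
    _ ≤ _ := by nlinarith [abs_nonneg (a m)]

/-! ### Convergence of the fluctuations of a kernel statistic. -/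

section Sample

variable {S Ω ι : Type*} [MeasurableSpace S] {mΩ : MeasurableSpace Ω} {μ : Measure S}
  {P : Measure Ω} {X : ℕ → Ω → S}
  {k : S → S → ℝ} {d₀ B : ℝ} {a : ι → ℝ} {e : ι → S → ℝ}

theorem aemeasurable_kernelStatistic (hX : ∀ i, HasLaw (X i) μ P)
    (hk : Measurable (Function.uncurry k)) (n : ℕ) :
    AEMeasurable (fun ω => kernelStatistic k n (X · ω)) P := by
  refine (Finset.aemeasurable_fun_sum _ fun j _ => ?_).const_mul _
  refine ((Finset.aemeasurable_fun_sum _ fun i _ => ?_).const_mul _).pow_const 2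
  exact hk.comp_aemeasurable ((hX j).aemeasurable.prodMk (hX i).aemeasurable)

theorem aemeasurable_truncatedFluctuation (hX : ∀ i, HasLaw (X i) μ P)
    (he : ∀ m, Measurable (e m)) (F : Finset ι) (n : ℕ) :
    AEMeasurable (fun ω => truncatedFluctuation d₀ a e F n (X · ω)) P := by
  have hz : ∀ m, AEMeasurable (fun ω => normalizedSum (e m) n (X · ω)) P := fun m =>
    aemeasurable_normalizedSum hX (he m) n
  refine ((Finset.aemeasurable_fun_sum _ fun m _ => ((hz m).pow_const 2).const_mul _).const_mul
    _).add ((Finset.aemeasurable_fun_sum _ fun j _ =>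
      (Finset.aemeasurable_fun_sum _ fun m _ => ?_).pow_const 2).const_mul _)
  exact (((he m).comp_aemeasurable (hX j).aemeasurable).const_mul _).mul (hz m)

theorem eLpNorm_four_mul_le {f g : Ω → ℝ} (hf : AEStronglyMeasurable f P)
    (hg : AEStronglyMeasurable g P) :
    eLpNorm (fun ω => f ω * g ω) 4 P ≤ eLpNorm f 8 P * eLpNorm g 8 P := by
  have : ENNReal.HolderTriple 8 8 4 := ⟨by
    rw [← two_mul, show (8 : ℝ≥0∞) = 2 * 4 by norm_num,
      ENNReal.mul_inv (by simp) (by simp), ← mul_assoc, ENNReal.mul_inv_cancel (by simp) (by simp),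
      one_mul]⟩
  simpa using eLpNorm_le_eLpNorm_mul_eLpNorm_of_nnnorm (p := 8) (q := 8) (r := 4) hf hg
    (fun x y : ℝ => x * y) 1 (ae_of_all _ fun ω => by simp)

/-- Hölder with 1/8 + 1/8 = 1/4 handles the product of sums. The factor ∑ ‖b m‖ₑ is isolated so that
`b` may be a tail of `a`, with the remaining constant independent of the truncation and of the
sample size. -/
theorem eLpNorm_four_le_of_abs_le [Countable ι] {z : ι → Ω → ℝ} {K : ℝ≥0∞}
    (hz : ∀ m, AEStronglyMeasurable (z m) P) (hz8 : ∀ m, eLpNorm (z m) 8 P ≤ K) (a b : ι → ℝ)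
    {s t : ℝ} {f : Ω → ℝ}
    (hf : ∀ ω, |f ω| ≤ s * (∑' m, b m * z m ω ^ 2)
      + t * ((∑' m, b m * |z m ω|) * ∑' m, a m * |z m ω|)) :
    eLpNorm f 4 P ≤ (‖s‖ₑ * K ^ 2 + ‖t‖ₑ * (K * ((∑' m, ‖a m‖ₑ) * K))) * ∑' m, ‖b m‖ₑ := by
  have habs : ∀ m, eLpNorm (fun ω => |z m ω|) 8 P ≤ K := fun m => by
    simpa only [← Real.norm_eq_abs, eLpNorm_norm] using hz8 m
  have hsq : ∀ m, eLpNorm (fun ω => z m ω ^ 2) 4 P ≤ K ^ 2 := fun m => by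
    rw [eLpNorm_sq, show (2 : ℝ≥0∞) * 4 = 8 by norm_num]
    exact pow_le_pow_left₀ zero_le (hz8 m) 2
  have hzabs : ∀ m, AEStronglyMeasurable (fun ω => |z m ω|) P := fun m => by
    simpa only [← Real.norm_eq_abs] using (hz m).norm
  have htsum : ∀ c : ι → ℝ, AEStronglyMeasurable (fun ω => ∑' m, c m * |z m ω|) P := fun c =>
    (AEMeasurable.tsum fun m => ((hzabs m).aemeasurable.const_mul _)).aestronglyMeasurable
  have htsum2 : AEStronglyMeasurable (fun ω => ∑' m, b m * z m ω ^ 2) P :=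
    (AEMeasurable.tsum fun m =>
      (((hz m).aemeasurable.pow_const 2).const_mul _)).aestronglyMeasurable
  have h1 := eLpNorm_tsum_mul_le (p := 4) (by norm_num) (fun m => ((hz m).pow 2)) hsq b
  have h2 := fun c : ι → ℝ => eLpNorm_tsum_mul_le (p := 8) (by norm_num) hzabs habs c
  have h3 := (eLpNorm_four_mul_le (htsum b) (htsum a)).trans (mul_le_mul' (h2 b) (h2 a))
  refine (eLpNorm_mono_real hf).trans ?_
  refine (eLpNorm_add_le (htsum2.const_mul s)
    (((htsum b).mul (htsum a)).const_mul t) (by norm_num)).trans ?_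
  calc _ ≤ ‖s‖ₑ * ((∑' m, ‖b m‖ₑ) * K ^ 2)
        + ‖t‖ₑ * ((∑' m, ‖b m‖ₑ) * K * ((∑' m, ‖a m‖ₑ) * K)) :=
        add_le_add ((eLpNorm_const_mul_le _ _ _).trans (mul_le_mul_right h1 _))
          ((eLpNorm_const_mul_le _ _ _).trans (mul_le_mul_right h3 _))
    _ = _ := by ring

/-- The `L⁴` error made by truncating the kernel. -/
theorem eLpNorm_fluctuation_sub_truncatedFluctuation_le [DecidableEq ι] [Countable ι]
    [IsProbabilityMeasure P] (hind : iIndepFun X P) (hX : ∀ i, HasLaw (X i) μ P)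
    (hk : ∀ x y, HasSum (fun m => a m * (e m x * e m y)) (k x y - d₀)) (hB : 0 ≤ B)
    (he : IsBoundedOrthonormal μ e B) (ha : Summable fun m => |a m|) :
    ∃ C : ℝ≥0∞, C ≠ ∞ ∧ ∀ (F : Finset ι) (n : ℕ),
      eLpNorm (fun ω => n * (kernelStatistic k n (X · ω) - d₀ ^ 2)
        - truncatedFluctuation d₀ a e F n (X · ω)) 4 P
      ≤ C * ∑' m, ‖if m ∈ F then 0 else |a m|‖ₑ := by
  obtain ⟨K, hK, hKtop⟩ : ∃ K : ℝ≥0∞, (∀ n m,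
      eLpNorm (fun ω => normalizedSum (e m) n (X · ω)) 8 P ≤ K) ∧ K ≠ ∞ :=
    ⟨_, fun n m => eLpNorm_normalizedSum_le hind hX (he.measurable m) (he.abs_le m)
      (he.integral_eq_zero m) n, ENNReal.rpow_ne_top_of_nonneg (by norm_num) (by finiteness)⟩
  have hA : ∑' m, ‖|a m|‖ₑ ≠ ∞ := by
    rw [tsum_enorm_ne_top_iff_summable_norm]
    simpa using ha
  refine ⟨_, ?_, fun F n => eLpNorm_four_le_of_abs_le
    (fun m => (aemeasurable_normalizedSum hX (he.measurable m) n).aestronglyMeasurable)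
    (hK n) (fun m => |a m|) _ fun ω =>
    abs_fluctuation_sub_truncatedFluctuation_le hB hk he.abs_le ha F n (X · ω)⟩
  finiteness

/-- A Slutsky argument: the truncated fluctuation is a fixed polynomial `g` in the normalized sums,
which converge in law, and in the empirical second moments of the e_m, which converge to the
identity matrix. At the identity the double sum collapses to its diagonal. -/
theorem tendstoInDistribution_truncatedFluctuation [DecidableEq ι] [IsProbabilityMeasure μ]
    [IsProbabilityMeasure P]
    (hind : iIndepFun X P) (hX : ∀ i, HasLaw (X i) μ P)
    (he : IsBoundedOrthonormal μ e B) (F : Finset ι) :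
    TendstoInDistribution (fun n ω => truncatedFluctuation d₀ a e F n (X · ω)) atTop
      (fun ξ : ι → ℝ => ∑ m ∈ F, (2 * d₀ * a m + a m ^ 2) * ξ m ^ 2) (fun _ => P)
      (gaussianFamily ι) := by
  have hM : ∀ n : ℕ, AEMeasurable (fun ω => fun q : F × F =>
      (n : ℝ)⁻¹ * ∑ j ∈ Finset.range n, e q.1 (X j ω) * e q.2 (X j ω)) P := fun n =>
    aemeasurable_pi_lambda _ fun q => (Finset.aemeasurable_fun_sum _ fun j _ =>
      ((he.measurable _).comp_aemeasurable (hX j).aemeasurable).mul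
        ((he.measurable _).comp_aemeasurable (hX j).aemeasurable)).const_mul _
  have hlln : TendstoInMeasure P (fun (n : ℕ) ω => fun q : F × F =>
      (n : ℝ)⁻¹ * ∑ j ∈ Finset.range n, e q.1 (X j ω) * e q.2 (X j ω)) atTop
      (fun _ => fun q : F × F => if q.1 = q.2 then (1 : ℝ) else 0) := by
    refine tendstoInMeasure_of_tendsto_ae (fun n => (hM n).aestronglyMeasurable) ?_
    simp only [tendsto_pi_nhds]
    rw [ae_all_iff]
    intro q
    set f : S → ℝ := fun x => e q.1 x * e q.2 x with hf
    have hfm : Measurable f := (he.measurable _).mul (he.measurable _)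
    have hfint : Integrable (fun ω => f (X 0 ω)) P := by
      refine Integrable.of_bound (hfm.comp_aemeasurable (hX 0).aemeasurable).aestronglyMeasurable
        (B * B) (ae_of_all _ fun ω => ?_)
      rw [hf, norm_mul]
      exact mul_le_mul (he.abs_le _ _) (he.abs_le _ _) (norm_nonneg _)
        ((abs_nonneg _).trans (he.abs_le q.1 (X 0 ω)))
    have h := strong_law_ae (fun i ω => f (X i ω)) hfint
      (fun i j hij => (hind.indepFun hij).comp hfm hfm)
      (fun i => (IdentDistrib.mk (hX i).aemeasurable (hX 0).aemeasurable
        ((hX i).map_eq.trans (hX 0).map_eq.symm)).comp hfm)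
    have hmean : ∫ ω, f (X 0 ω) ∂P = if q.1 = q.2 then 1 else 0 := by
      refine ((hX 0).integral_comp hfm.aestronglyMeasurable).trans ?_
      simp only [hf, he.integral_mul, Subtype.coe_inj]
    simpa only [smul_eq_mul, hmean] using h
  let g : EuclideanSpace ℝ F × (F × F → ℝ) → ℝ := fun y =>
    2 * d₀ * ∑ m : F, a m * y.1 m ^ 2
      + ∑ m : F, ∑ l : F, a m * a l * (y.1 m * y.1 l) * y.2 (m, l)
  have hg : Continuous g := by fun_prop
  have h := (tendstoInDistribution_normalizedSum he hind hX F
    ).continuous_comp_prodMk_of_tendstoInMeasure_const hg hlln hM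
  convert! h using 2 with n
  · ext ω
    simp only [g, truncatedFluctuation]
    rw [← Finset.sum_coe_sort F]
    congr 1
    simp only [← Finset.sum_coe_sort F, sq, Finset.sum_mul_sum]
    rw [Finset.sum_comm, Finset.mul_sum]
    refine Finset.sum_congr rfl fun m _ => ?_
    rw [Finset.sum_comm, Finset.mul_sum]
    refine Finset.sum_congr rfl fun l _ => ?_
    simp only [Finset.mul_sum]
    exact Finset.sum_congr rfl fun j _ => by ring
  · rename_i ξ
    simp only [g, Finset.restrict, mul_ite, mul_one, mul_zero, Finset.sum_ite_eq, Finset.mem_univ,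
      if_true]
    rw [← Finset.sum_coe_sort F, Finset.mul_sum, ← Finset.sum_add_distrib]
    exact Finset.sum_congr rfl fun m _ => by ring

/-- The fluctuations of the kernel statistic of a sample converge in distribution to a weighted
chi-squared sum. -/
theorem tendstoInDistribution_fluctuation [DecidableEq ι] [Countable ι] [IsProbabilityMeasure μ]
    [IsProbabilityMeasure P] (hind : iIndepFun X P) (hX : ∀ i, HasLaw (X i) μ P)
    (hkm : Measurable (Function.uncurry k))
    (hk : ∀ x y, HasSum (fun m => a m * (e m x * e m y)) (k x y - d₀)) (hB : 0 ≤ B)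
    (he : IsBoundedOrthonormal μ e B) (ha : Summable fun m => |a m|) :
    TendstoInDistribution (fun (n : ℕ) ω => (n : ℝ) * (kernelStatistic k n (X · ω) - d₀ ^ 2)) atTop
      (weightedChiSq fun m => 2 * d₀ * a m + a m ^ 2) (fun _ => P) (gaussianFamily ι) := by
  obtain ⟨C, hC, hCF⟩ := eLpNorm_fluctuation_sub_truncatedFluctuation_le hind hX hk hB he ha
  obtain ⟨K, hK, hKF⟩ := eLpNorm_weightedChiSq_sub_sum_le (ι := ι) (p := 1) le_rfl
  have hmeas : ∀ n : ℕ, AEMeasurable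
      (fun ω => (n : ℝ) * (kernelStatistic k n (X · ω) - d₀ ^ 2)) P := fun n =>
    ((aemeasurable_kernelStatistic hX hkm n).sub_const _).const_mul _
  refine tendstoInDistribution_of_approx hmeas (measurable_weightedChiSq _).aemeasurable
    fun ε hε => ?_
  have t1 := ENNReal.Tendsto.const_mul (tendsto_tsum_enorm_compl ha) (Or.inr hC)
  have t2 := ENNReal.Tendsto.const_mul
    (tendsto_tsum_enorm_compl (summable_abs_quadratic d₀ ha)) (Or.inr hK)
  rw [mul_zero] at t1 t2
  have hε' : (0 : ℝ≥0∞) < ENNReal.ofReal ε := ENNReal.ofReal_pos.2 hε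
  -- The constants `C` and `K` do not depend on `F`, nor `C` on `n`, so one `F` serves all `n` and
  -- the limit together.
  obtain ⟨F, h1, h2⟩ := ((t1.eventually_lt_const hε').and (t2.eventually_lt_const hε')).exists
  refine ⟨_, _, tendstoInDistribution_truncatedFluctuation (d₀ := d₀) (a := a) hind hX he F,
    fun n => ?_, ?_⟩
  · refine (eLpNorm_le_eLpNorm_of_exponent_le (q := 4) (by norm_num) ?_).trans
      ((hCF F n).trans h1.le)
    exact ((hmeas n).sub
      (aemeasurable_truncatedFluctuation hX he.measurable F n)).aestronglyMeasurable
  · exact (hKF _ (summable_abs_quadratic d₀ ha) F).trans h2.le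

/-- This is the truncation estimate for `F = ∅`, where the truncated fluctuation is zero. -/
theorem exists_eLpNorm_fluctuation_le [DecidableEq ι] [Countable ι]
    [IsProbabilityMeasure P] (hind : iIndepFun X P) (hX : ∀ i, HasLaw (X i) μ P)
    (hk : ∀ x y, HasSum (fun m => a m * (e m x * e m y)) (k x y - d₀)) (hB : 0 ≤ B)
    (he : IsBoundedOrthonormal μ e B) (ha : Summable fun m => |a m|) :
    ∃ C : ℝ, ∀ n : ℕ,
      eLpNorm (fun ω => (n : ℝ) * (kernelStatistic k n (X · ω) - d₀ ^ 2)) 4 P ≤ ENNReal.ofReal C := by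
  obtain ⟨C, hC, h⟩ := eLpNorm_fluctuation_sub_truncatedFluctuation_le hind hX hk hB he ha
  have hA : ∑' m, ‖|a m|‖ₑ ≠ ∞ := by
    rw [tsum_enorm_ne_top_iff_summable_norm]
    simpa using ha
  refine ⟨(C * ∑' m, ‖|a m|‖ₑ).toReal, fun n => ?_⟩
  rw [ENNReal.ofReal_toReal (by finiteness)]
  simpa [truncatedFluctuation] using h ∅ n

end Sample

/-! ### Gaussian moments, and second and third moments of independent sums. -/

theorem integral_pow_even_gaussianReal (k : ℕ) :
    ∫ x, x ^ (2 * k) ∂(gaussianReal 0 1) = (Nat.doubleFactorial (2 * k - 1) : ℝ) := by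
  have hI : ∫ x : ℝ, x ^ (2 * k) * Real.exp (-(1 / 2) * x ^ 2)
      = 2 * ((1 / 2 : ℝ) ^ (-(2 * k + 1 : ℝ) / 2) * (1 / 2) * Real.Gamma ((2 * k + 1 : ℝ) / 2)) := by
    have h1 := integral_comp_abs (f := fun x : ℝ => x ^ (2 * k) * Real.exp (-(1 / 2) * x ^ 2))
    simp only [sq_abs, Even.pow_abs (even_two_mul k)] at h1
    rw [h1]
    have h2 := integral_rpow_mul_exp_neg_mul_rpow (p := 2) (q := 2 * k) (b := 1 / 2) (by norm_num)
      (by have : (0 : ℝ) ≤ k := by positivity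
          linarith) (by norm_num)
    rw [← h2]
    congr 1
    refine setIntegral_congr_fun measurableSet_Ioi fun x _ => ?_
    simp only [Real.rpow_ofNat]
    rw [← Real.rpow_natCast x (2 * k)]
    push_cast
    rfl
  rw [integral_gaussianReal_eq_integral_smul one_ne_zero]
  have h3 : ∀ x : ℝ, gaussianPDFReal 0 1 x • x ^ (2 * k)
      = (√(2 * Real.pi))⁻¹ * (x ^ (2 * k) * Real.exp (-(1 / 2) * x ^ 2)) := fun x => by
    simp only [gaussianPDFReal, NNReal.coe_one, mul_one, sub_zero, smul_eq_mul]
    ring_nf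
  simp only [h3]
  rw [integral_const_mul, hI, show ((2 * k + 1 : ℝ) / 2) = k + 1 / 2 by ring,
    Real.Gamma_nat_add_half, show (-(2 * k + 1 : ℝ) / 2) = -(k + 1 / 2 : ℝ) by ring,
    Real.rpow_neg (by norm_num), Real.rpow_add (by norm_num), Real.rpow_natCast,
    ← Real.sqrt_eq_rpow, Real.sqrt_mul (by norm_num), one_div, Real.sqrt_inv]
  have : √(2 : ℝ) ≠ 0 := by positivity
  have : √Real.pi ≠ 0 := by positivity
  rw [inv_pow]
  field_simp

section Moments

variable {Ω : Type*} {mΩ : MeasurableSpace Ω} {P : Measure Ω} [IsProbabilityMeasure P]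

/-- `W` is a centered variable in `L³` with variance `s` and third moment `t`. -/
structure HasCenteredMoments (W : Ω → ℝ) (s t : ℝ) (P : Measure Ω) : Prop where
  measurable : Measurable W
  memLp : MemLp W 3 P
  integral_eq : ∫ ω, W ω ∂P = 0
  integral_sq : ∫ ω, W ω ^ 2 ∂P = s
  integral_cube : ∫ ω, W ω ^ 3 ∂P = t

theorem HasCenteredMoments.integrable_pow {W : Ω → ℝ} {s t : ℝ} (h : HasCenteredMoments W s t P)
    {k : ℕ} (hk : k ≤ 3) : Integrable (fun ω => W ω ^ k) P := by
  have h1 : MemLp W k P := h.memLp.mono_exponent (by exact_mod_cast hk)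
  have := h1.integrable_norm_pow'
  refine this.mono (h.measurable.pow_const k).aestronglyMeasurable (ae_of_all _ fun ω => ?_)
  simp

/-- Every cross term of order two or three contains a first moment, which is zero. Third order is
the last for which this holds. -/
theorem HasCenteredMoments.add {W W' : Ω → ℝ} {s t s' t' : ℝ} (h : HasCenteredMoments W s t P)
    (h' : HasCenteredMoments W' s' t' P) (hind : IndepFun W W' P) :
    HasCenteredMoments (W + W') (s + s') (t + t') P := by
  have hW := h.measurable
  have hW' := h'.measurable
  have hmul : ∀ i j : ℕ, i ≤ 3 → j ≤ 3 → Integrable (fun ω => W ω ^ i * W' ω ^ j) P ∧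
      ∫ ω, W ω ^ i * W' ω ^ j ∂P = (∫ ω, W ω ^ i ∂P) * ∫ ω, W' ω ^ j ∂P := fun i j hi hj => by
    have hij : IndepFun (fun ω => W ω ^ i) (fun ω => W' ω ^ j) P :=
      hind.comp (φ := fun x => x ^ i) (ψ := fun x => x ^ j) (by fun_prop) (by fun_prop)
    exact ⟨hij.integrable_mul (h.integrable_pow hi) (h'.integrable_pow hj),
      hij.integral_fun_mul_eq_mul_integral (by fun_prop) (by fun_prop)⟩
  have p1 := h.integrable_pow (k := 1) (by norm_num)
  have p1' := h'.integrable_pow (k := 1) (by norm_num)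
  have p2 := h.integrable_pow (k := 2) (by norm_num)
  have p2' := h'.integrable_pow (k := 2) (by norm_num)
  have p3 := h.integrable_pow (k := 3) (by norm_num)
  have p3' := h'.integrable_pow (k := 3) (by norm_num)
  have i1 : ∫ ω, W ω ^ 1 ∂P = 0 := by simpa using h.integral_eq
  have i1' : ∫ ω, W' ω ^ 1 ∂P = 0 := by simpa using h'.integral_eq
  refine ⟨hW.add hW', h.memLp.add h'.memLp, ?_, ?_, ?_⟩
  · simp only [pow_one] at p1 p1'
    simp only [Pi.add_apply]
    rw [integral_add p1 p1', h.integral_eq, h'.integral_eq, add_zero]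
  · obtain ⟨m1, m2⟩ := hmul 1 1 (by norm_num) (by norm_num)
    have : ∀ ω, (W + W') ω ^ 2 = W ω ^ 2 + 2 * (W ω ^ 1 * W' ω ^ 1) + W' ω ^ 2 := fun ω => by
      simp only [Pi.add_apply]; ring
    simp only [this]
    rw [integral_add (p2.fun_add (m1.const_mul 2)) p2', integral_add p2 (m1.const_mul 2),
      integral_const_mul, m2, i1, h.integral_sq, h'.integral_sq]
    ring
  · obtain ⟨m1, m2⟩ := hmul 2 1 (by norm_num) (by norm_num)
    obtain ⟨n1, n2⟩ := hmul 1 2 (by norm_num) (by norm_num)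
    have : ∀ ω, (W + W') ω ^ 3 = W ω ^ 3 + 3 * (W ω ^ 2 * W' ω ^ 1)
        + 3 * (W ω ^ 1 * W' ω ^ 2) + W' ω ^ 3 := fun ω => by
      simp only [Pi.add_apply]; ring
    simp only [this]
    rw [integral_add ((p3.fun_add (m1.const_mul 3)).fun_add (n1.const_mul 3)) p3',
      integral_add (p3.fun_add (m1.const_mul 3)) (n1.const_mul 3), integral_add p3 (m1.const_mul 3),
      integral_const_mul, integral_const_mul, m2, n2, i1, i1', h.integral_cube, h'.integral_cube]
    ring

theorem HasCenteredMoments.sum {ι : Type*} [DecidableEq ι] {W : ι → Ω → ℝ} {s t : ι → ℝ}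
    (h : ∀ m, HasCenteredMoments (W m) (s m) (t m) P) (hind : iIndepFun W P) (F : Finset ι) :
    HasCenteredMoments (∑ m ∈ F, W m) (∑ m ∈ F, s m) (∑ m ∈ F, t m) P := by
  induction F using Finset.induction_on with
  | empty => exact ⟨measurable_const, by simp, by simp, by simp, by simp⟩
  | insert m F hm ih =>
    simp only [Finset.sum_insert hm]
    exact (h m).add ih
      (hind.indepFun_finsetSum_of_notMem (fun m => (h m).measurable) hm).symm

end Moments

section ChiSq

variable {ι : Type*}

/-- The Gaussian moments 1, 3, 15 give E(ξ² - 1)² = 3 - 2 + 1 = 2 and E(ξ² - 1)³ = 15 - 9 + 3 - 1 =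
8. -/
theorem hasCenteredMoments_chiSq (c : ℝ) (m : ι) :
    HasCenteredMoments (fun ξ : ι → ℝ => c * (ξ m ^ 2 - 1)) (2 * c ^ 2) (8 * c ^ 3)
      (gaussianFamily ι) := by
  have hmp := measurePreserving_eval_infinitePi (fun _ : ι => gaussianReal 0 1) m
  have hintg : ∀ k : ℕ, Integrable (fun x : ℝ => x ^ k) (gaussianReal 0 1) := fun k => by
    have := (memLp_id_gaussianReal (μ := 0) (v := 1) k).integrable_norm_pow'
    refine this.mono (by fun_prop) (ae_of_all _ fun ω => ?_)
    simp
  have e2 := integral_pow_even_gaussianReal 1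
  have e4 := integral_pow_even_gaussianReal 2
  have e6 := integral_pow_even_gaussianReal 3
  norm_num [Nat.doubleFactorial] at e2 e4 e6
  have hcomp : ∀ f : ℝ → ℝ, Measurable f →
      ∫ ξ : ι → ℝ, f (ξ m) ∂(gaussianFamily ι) = ∫ x, f x ∂(gaussianReal 0 1) := fun f hf => by
    rw [← hmp.map_eq, integral_map hmp.aemeasurable hf.aestronglyMeasurable]
  refine ⟨by fun_prop, ?_, ?_, ?_, ?_⟩
  · obtain ⟨K, hK, h⟩ := exists_eLpNorm_sq_eval_gaussianFamily_le ι 3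
    refine MemLp.const_mul (MemLp.sub ⟨((measurable_pi_apply m).pow_const 2).aestronglyMeasurable,
      (h m).trans_lt hK.lt_top⟩ (memLp_const 1)) c
  · rw [hcomp (fun x => c * (x ^ 2 - 1)) (by fun_prop), integral_const_mul,
      integral_sub (hintg 2) (integrable_const _), e2]
    simp
  · rw [hcomp (fun x => (c * (x ^ 2 - 1)) ^ 2) (by fun_prop)]
    have : ∀ x : ℝ, (c * (x ^ 2 - 1)) ^ 2 = c ^ 2 * (x ^ 4 + (-2) * x ^ 2 + 1) := fun x => by ring
    simp only [this]
    rw [integral_const_mul, integral_add ((hintg 4).fun_add ((hintg 2).const_mul _)) (integrable_const _),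
      integral_add (hintg 4) ((hintg 2).const_mul _), integral_const_mul, e2, e4]
    simp
    ring
  · rw [hcomp (fun x => (c * (x ^ 2 - 1)) ^ 3) (by fun_prop)]
    have : ∀ x : ℝ, (c * (x ^ 2 - 1)) ^ 3 = c ^ 3 * (x ^ 6 + (-3) * x ^ 4 + 3 * x ^ 2 - 1) :=
      fun x => by ring
    simp only [this]
    rw [integral_const_mul,
      integral_sub (((hintg 6).fun_add ((hintg 4).const_mul _)).fun_add ((hintg 2).const_mul 3))
        (integrable_const _),
      integral_add ((hintg 6).fun_add ((hintg 4).const_mul _)) ((hintg 2).const_mul 3),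
      integral_add (hintg 6) ((hintg 4).const_mul _), integral_const_mul, integral_const_mul,
      e2, e4, e6]
    simp
    ring

theorem memLp_weightedChiSq [Countable ι] {c : ι → ℝ} (hc : Summable fun m => |c m|) {p : NNReal}
    (hp : 1 ≤ p) : MemLp (weightedChiSq c) p (gaussianFamily ι) := by
  classical
  obtain ⟨K, hK, h⟩ := eLpNorm_weightedChiSq_sub_sum_le (ι := ι) hp
  refine ⟨(measurable_weightedChiSq c).aestronglyMeasurable, ?_⟩
  have hA : ∑' m, ‖|c m|‖ₑ ≠ ∞ := by
    rw [tsum_enorm_ne_top_iff_summable_norm]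
    simpa using hc
  have h1 := h c hc ∅
  simp only [Finset.sum_empty, sub_zero, Finset.notMem_empty, if_false] at h1
  exact h1.trans_lt (ENNReal.mul_lt_top hK.lt_top hA.lt_top)

/-- The first three moments of a centered weighted chi-squared sum. -/
theorem hasCenteredMoments_weightedChiSq [Countable ι] {c : ι → ℝ}
    (hc : Summable fun m => |c m|) {s t : ℝ} (hs : HasSum (fun m => c m ^ 2) s)
    (ht : HasSum (fun m => c m ^ 3) t) :
    HasCenteredMoments (fun ξ => weightedChiSq c ξ - ∑' m, c m) (2 * s) (8 * t)
      (gaussianFamily ι) := by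
  classical
  obtain ⟨W, hW⟩ : ∃ W : ι → (ι → ℝ) → ℝ, ∀ m ξ, W m ξ = c m * (ξ m ^ 2 - 1) :=
    ⟨_, fun _ _ => rfl⟩
  have hfin : ∀ F : Finset ι, HasCenteredMoments (∑ m ∈ F, W m) (∑ m ∈ F, 2 * c m ^ 2)
      (∑ m ∈ F, 8 * c m ^ 3) (gaussianFamily ι) := by
    obtain rfl : W = fun m ξ => c m * (ξ m ^ 2 - 1) := funext fun m => funext fun ξ => hW m ξ
    exact HasCenteredMoments.sum (fun m => hasCenteredMoments_chiSq (c m) m)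
      (iIndepFun_infinitePi (P := fun _ : ι => gaussianReal 0 1)
        (X := fun m x => c m * (x ^ 2 - 1)) fun m => by fun_prop)
  obtain ⟨F, hF⟩ := exists_seq_tendsto (atTop : Filter (Finset ι))
  have hmeas : Measurable fun ξ => weightedChiSq c ξ - ∑' m, c m :=
    (measurable_weightedChiSq c).sub_const _
  have hmem3 : MemLp (fun ξ => weightedChiSq c ξ - ∑' m, c m) 3 (gaussianFamily ι) :=
    (memLp_weightedChiSq hc (p := 3) (by norm_num)).sub (memLp_const _)
  -- Since |c_m (ξ_m² - 1)| ≤ |c_m| ξ_m² + |c_m|, `G` dominates all finite partial sums. It lies in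
  -- L³, which allows dominated convergence of the first three moments.
  set G : (ι → ℝ) → ℝ := fun ξ => weightedChiSq (fun m => |c m|) ξ + ∑' m, |c m| with hG
  have hG3 : MemLp G 3 (gaussianFamily ι) :=
    (memLp_weightedChiSq (by simpa using hc) (p := 3) (by norm_num)).add (memLp_const _)
  have hlim : ∀ k : ℕ, k ≤ 3 → Tendsto
      (fun n => ∫ ξ, (∑ m ∈ F n, W m) ξ ^ k ∂(gaussianFamily ι))
      atTop (𝓝 (∫ ξ, (weightedChiSq c ξ - ∑' m, c m) ^ k ∂(gaussianFamily ι))) := fun k hk => by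
    refine tendsto_integral_of_dominated_convergence (fun ξ => ‖G ξ‖ ^ k)
      (fun n => (((hfin (F n)).measurable).pow_const k).aestronglyMeasurable) ?_ (fun n => ?_) ?_
    · have : MemLp G k (gaussianFamily ι) := hG3.mono_exponent (by exact_mod_cast hk)
      exact this.integrable_norm_pow'
    · filter_upwards [ae_summable_abs_mul_sq hc] with ξ hξ
      rw [norm_pow]
      refine pow_le_pow_left₀ (norm_nonneg _) ?_ k
      refine le_trans ?_ (le_abs_self _)
      simp only [hG, weightedChiSq, Finset.sum_apply]
      rw [← hξ.tsum_add hc]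
      refine (norm_sum_le _ _).trans (le_trans (Finset.sum_le_sum fun m _ => ?_)
        ((hξ.add hc).sum_le_tsum (F n) fun m _ => by positivity))
      rw [hW, norm_mul, Real.norm_eq_abs, Real.norm_eq_abs]
      have : |ξ m ^ 2 - 1| ≤ ξ m ^ 2 + 1 := by
        rw [abs_le]; constructor <;> nlinarith [sq_nonneg (ξ m)]
      nlinarith [abs_nonneg (c m)]
    · filter_upwards [ae_summable_abs_mul_sq hc] with ξ hξ
      refine Tendsto.pow ?_ k
      have h1 : Summable fun m => c m * ξ m ^ 2 := hξ.of_norm_bounded fun m => by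
        rw [norm_mul, Real.norm_eq_abs, Real.norm_of_nonneg (sq_nonneg _)]
      have h2 : Tendsto (fun n => ∑ m ∈ F n, (c m * ξ m ^ 2 - c m)) atTop
          (𝓝 (∑' m, c m * ξ m ^ 2 - ∑' m, c m)) :=
        (h1.hasSum.sub (Summable.hasSum (f := c) hc.of_abs)).comp hF
      simp only [Finset.sum_apply, weightedChiSq]
      refine h2.congr fun n => ?_
      exact Finset.sum_congr rfl fun m _ => by rw [hW]; ring
  refine ⟨hmeas, hmem3, ?_, ?_, ?_⟩
  · have h := hlim 1 (by norm_num)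
    simp only [pow_one] at h
    exact tendsto_nhds_unique h
      (tendsto_const_nhds.congr fun n => (hfin (F n)).integral_eq.symm)
  · exact tendsto_nhds_unique (hlim 2 (by norm_num))
      (((hs.mul_left 2).comp hF).congr fun n => (hfin (F n)).integral_sq.symm)
  · exact tendsto_nhds_unique (hlim 3 (by norm_num))
      (((ht.mul_left 8).comp hF).congr fun n => (hfin (F n)).integral_cube.symm)

end ChiSq

/-! ### Orthonormality of the trigonometric functions of odd frequency. -/

section Fourier

/-- For n ≠ 0, translation by half a period of the character changes its sign. -/
theorem integral_fourier_volume (n : ℤ) :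
    ∫ x : UnitAddCircle, fourier n x = if n = 0 then 1 else 0 := by
  split_ifs with h
  · simp [h, measureReal_def]
  · exact integral_eq_zero_of_add_right_eq_neg (μ := (volume : Measure UnitAddCircle))
      (fourier_add_half_inv_index h one_pos)

theorem integrable_fourier (n : ℤ) :
    Integrable (fun x : UnitAddCircle => fourier n x) volume :=
  (map_continuous (fourier n)).integrable_of_hasCompactSupport (HasCompactSupport.of_compactSpace _)

theorem integral_re_fourier (n : ℤ) :
    ∫ x : UnitAddCircle, (fourier n x).re = if n = 0 then 1 else 0 := by
  have h := integral_re (integrable_fourier n)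
  simp only [RCLike.re_to_complex] at h
  rw [h, integral_fourier_volume]
  split_ifs <;> simp

theorem integral_im_fourier (n : ℤ) : ∫ x : UnitAddCircle, (fourier n x).im = 0 := by
  have h := integral_im (integrable_fourier n)
  simp only [RCLike.im_to_complex] at h
  rw [h, integral_fourier_volume]
  split_ifs <;> simp

/-- The normalized real trigonometric functions of odd frequency `2j + 1`: the cosine for
`(j, true)`, the sine for `(j, false)`. -/
noncomputable def oddTrig (m : ℕ × Bool) (x : UnitAddCircle) : ℝ :=
  √2 * bif m.2 then (fourier (2 * m.1 + 1 : ℤ) x).re else (fourier (2 * m.1 + 1 : ℤ) x).im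

theorem isBoundedOrthonormal_oddTrig :
    IsBoundedOrthonormal (volume : Measure UnitAddCircle) oddTrig √2 := by
  have hcont : ∀ n : ℤ, Continuous fun x : UnitAddCircle => fourier n x := fun n =>
    map_continuous (fourier n)
  have hre : ∀ n : ℤ, Integrable (fun x : UnitAddCircle => (fourier n x).re) volume := fun n =>
    (integrable_fourier n).re
  have him : ∀ n : ℤ, Integrable (fun x : UnitAddCircle => (fourier n x).im) volume := fun n =>
    (integrable_fourier n).im
  have hsq : √(2 : ℝ) * √2 = 2 := Real.mul_self_sqrt (by norm_num)
  have hadd : ∀ (k l : ℤ) (x : UnitAddCircle), fourier (k + l) x = fourier k x * fourier l x :=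
    fun k l x => fourier_add
  have hsub : ∀ (k l : ℤ) (x : UnitAddCircle),
      fourier (k - l) x = fourier k x * (starRingEnd ℂ) (fourier l x) := fun k l x => by
    rw [sub_eq_add_neg, fourier_add, fourier_neg]
  refine ⟨?_, ?_, ?_, ?_⟩
  · rintro ⟨j, b⟩
    cases b
    · exact ((Complex.continuous_im.comp (hcont _)).measurable).const_mul _
    · exact ((Complex.continuous_re.comp (hcont _)).measurable).const_mul _
  · rintro ⟨j, b⟩ x
    have hn : ‖fourier (2 * j + 1 : ℤ) x‖ = 1 := by rw [fourier_apply]; exact Circle.norm_coe _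
    rw [oddTrig, abs_mul, abs_of_nonneg (Real.sqrt_nonneg 2)]
    refine mul_le_of_le_one_right (Real.sqrt_nonneg 2) ?_
    cases b
    · exact (Complex.abs_im_le_norm _).trans hn.le
    · exact (Complex.abs_re_le_norm _).trans hn.le
  · rintro ⟨j, b⟩
    cases b
    · simp only [oddTrig, cond_false, integral_const_mul, integral_im_fourier, mul_zero]
    · simp only [oddTrig, cond_true, integral_const_mul, integral_re_fourier]
      rw [if_neg (by lia), mul_zero]
  · rintro ⟨j, b⟩ ⟨l, b'⟩
    set p : ℤ := 2 * j + 1 with hp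
    set q : ℤ := 2 * l + 1 with hq
    -- Both frequencies are positive, so in the product formulas only the frequency `p - q` can
    -- contribute a nonzero integral.
    have hpq : p + q ≠ 0 := by lia
    have hpq' : p - q = 0 ↔ j = l := by lia
    have e1 := integral_re_fourier (p + q)
    have e2 := integral_re_fourier (p - q)
    have e3 := integral_im_fourier (p + q)
    have e4 := integral_im_fourier (p - q)
    rw [if_neg hpq] at e1
    simp only [hpq'] at e2
    cases b <;> cases b'
    · have : ∀ x, oddTrig (j, false) x * oddTrig (l, false) x
          = (fourier (p - q) x).re - (fourier (p + q) x).re := fun x => by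
        rw [hadd, hsub]
        simp only [oddTrig, cond_false, Complex.mul_re, Complex.conj_re, Complex.conj_im, ← hp, ← hq]
        linear_combination (fourier p x).im * (fourier q x).im * hsq
      simp only [this]
      rw [integral_sub (hre _) (hre _), e1, e2]
      simp
    · have : ∀ x, oddTrig (j, false) x * oddTrig (l, true) x
          = (fourier (p + q) x).im + (fourier (p - q) x).im := fun x => by
        rw [hadd, hsub]
        simp only [oddTrig, cond_false, cond_true, Complex.mul_im, Complex.conj_re, Complex.conj_im,
          ← hp, ← hq]
        linear_combination (fourier p x).im * (fourier q x).re * hsq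
      simp only [this]
      rw [integral_add (him _) (him _), e3, e4]
      simp
    · have : ∀ x, oddTrig (j, true) x * oddTrig (l, false) x
          = (fourier (p + q) x).im - (fourier (p - q) x).im := fun x => by
        rw [hadd, hsub]
        simp only [oddTrig, cond_false, cond_true, Complex.mul_im, Complex.conj_re, Complex.conj_im,
          ← hp, ← hq]
        linear_combination (fourier p x).re * (fourier q x).im * hsq
      simp only [this]
      rw [integral_sub (him _) (him _), e3, e4]
      simp
    · have : ∀ x, oddTrig (j, true) x * oddTrig (l, true) x
          = (fourier (p - q) x).re + (fourier (p + q) x).re := fun x => by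
        rw [hadd, hsub]
        simp only [oddTrig, cond_true, Complex.mul_re, Complex.conj_re, Complex.conj_im, ← hp, ← hq]
        linear_combination (fourier p x).re * (fourier q x).re * hsq
      simp only [this]
      rw [integral_add (hre _) (hre _), e1, e2]
      simp

end Fourier

/-! ### Sums of inverse even powers of the odd integers. -/

section OddSums

theorem HasSum.odd_of_even {f : ℕ → ℝ} {s s₀ : ℝ} (hf : HasSum f s)
    (h₀ : HasSum (fun j => f (2 * j)) s₀) : HasSum (fun j => f (2 * j + 1)) (s - s₀) := by
  have h1 : Summable fun j => f (2 * j + 1) :=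
    hf.summable.comp_injective (i := fun j : ℕ => 2 * j + 1) fun a b h => by
      simpa using h
  have h2 := (h₀.even_add_odd h1.hasSum).unique hf
  rw [← h2, add_sub_cancel_left]
  exact h1.hasSum

/-- The even integers contribute the fraction 4^(-k) of ζ(2k). -/
theorem hasSum_one_div_odd_pow {k : ℕ} (hk : k ≠ 0) :
    HasSum (fun j : ℕ => 1 / ((2 * j + 1 : ℕ) : ℝ) ^ (2 * k))
      ((1 - 1 / 4 ^ k) * ((-1 : ℝ) ^ (k + 1) * (2 : ℝ) ^ (2 * k - 1) * Real.pi ^ (2 * k) *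
        bernoulli (2 * k) / (Nat.factorial (2 * k)))) := by
  have h := hasSum_zeta_nat hk
  have h0 : (fun j : ℕ => (1 / 4 ^ k : ℝ) * (1 / (j : ℝ) ^ (2 * k)))
      = fun j : ℕ => 1 / ((2 * j : ℕ) : ℝ) ^ (2 * k) := by
    ext j
    push_cast
    rw [mul_pow, pow_mul 2 2 k]
    norm_num
    ring
  convert! h.odd_of_even (h0 ▸ h.mul_left (1 / 4 ^ k : ℝ)) using 1
  ring

/-- The odd-index values vanish, so the recursion for the Bernoulli numbers determines each
even-index value from the previous ones. -/
theorem bernoulli_values : bernoulli 4 = -1 / 30 ∧ bernoulli 6 = 1 / 42 ∧ bernoulli 8 = -1 / 30 ∧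
    bernoulli 10 = 5 / 66 ∧ bernoulli 12 = -691 / 2730 := by
  have b5 : bernoulli' 5 = 0 := bernoulli'_eq_zero_of_odd (by decide) (by norm_num)
  have b7 : bernoulli' 7 = 0 := bernoulli'_eq_zero_of_odd (by decide) (by norm_num)
  have b9 : bernoulli' 9 = 0 := bernoulli'_eq_zero_of_odd (by decide) (by norm_num)
  have b11 : bernoulli' 11 = 0 := bernoulli'_eq_zero_of_odd (by decide) (by norm_num)
  have b6 : bernoulli' 6 = 1 / 42 := by
    have := sum_bernoulli' 7
    norm_num [Finset.sum_range_succ, Nat.choose, b5] at this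
    linarith
  have b8 : bernoulli' 8 = -1 / 30 := by
    have := sum_bernoulli' 9
    norm_num [Finset.sum_range_succ, Nat.choose, b5, b6, b7] at this
    linarith
  have b10 : bernoulli' 10 = 5 / 66 := by
    have := sum_bernoulli' 11
    norm_num [Finset.sum_range_succ, Nat.choose, b5, b6, b7, b8, b9] at this
    linarith
  have b12 : bernoulli' 12 = -691 / 2730 := by
    have := sum_bernoulli' 13
    norm_num [Finset.sum_range_succ, Nat.choose, b5, b6, b7, b8, b9, b10, b11] at this
    linarith
  refine ⟨?_, ?_, ?_, ?_, ?_⟩ <;> rw [bernoulli_eq_bernoulli'_of_ne_one (by norm_num)]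
  · exact bernoulli'_four
  · exact b6
  · exact b8
  · exact b10
  · exact b12

end OddSums

/-! ### Spectral expansion of the circle distance and the power sums of its weights. -/

section Distance

/-- The eigenvalues of the distance kernel of the circle. -/
noncomputable def circleEigenvalue (j : ℕ) : ℝ := -(1 / (Real.pi ^ 2 * ((2 * j + 1 : ℕ) : ℝ) ^ 2))

theorem eval_bernoulli_two (x : ℝ) :
    ((Polynomial.bernoulli (2 * 1)).map (algebraMap ℚ ℝ)).eval x = x ^ 2 - x + 1 / 6 := by
  simp [Polynomial.bernoulli, Finset.sum_range_succ]
  ring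

/-- The even-frequency terms of the Fourier series of the second Bernoulli polynomial at `u` are a
quarter of the series at `2 * u`; subtracting them cancels the quadratic part. The bound u ≤ 1/2
keeps `2 * u` in [0, 1]. -/
theorem hasSum_cos_odd {u : ℝ} (h0 : 0 ≤ u) (h1 : u ≤ 1 / 2) :
    HasSum (fun j : ℕ => 1 / ((2 * j + 1 : ℕ) : ℝ) ^ 2 * Real.cos (2 * Real.pi * (2 * j + 1 : ℕ) * u))
      (Real.pi ^ 2 * (1 / 8 - u / 2)) := by
  have hA := hasSum_one_div_nat_pow_mul_cos one_ne_zero (x := u) ⟨h0, by linarith⟩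
  have hB := hasSum_one_div_nat_pow_mul_cos one_ne_zero (x := 2 * u) ⟨by linarith, by linarith⟩
  rw [eval_bernoulli_two] at hA hB
  have h := hA.odd_of_even ((hB.mul_left (1 / 4)).congr_fun fun j => by
    push_cast
    rw [show 2 * Real.pi * (2 * (j : ℝ)) * u = 2 * Real.pi * j * (2 * u) by ring]
    norm_num [mul_pow]
    ring)
  convert! h using 1
  norm_num
  ring

theorem hasSum_norm_unitAddCircle (z : UnitAddCircle) :
    HasSum (fun j : ℕ => 2 * circleEigenvalue j * (fourier (2 * j + 1 : ℤ) z).re) (‖z‖ - 1 / 4) := by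
  obtain ⟨x, rfl⟩ := QuotientAddGroup.mk_surjective z
  have hcos : ∀ j : ℕ, (fourier (2 * j + 1 : ℤ) (x : UnitAddCircle)).re
      = Real.cos (2 * Real.pi * (2 * j + 1 : ℕ) * |x - round x|) := fun j => by
    have h1 : (fourier (2 * j + 1 : ℤ) (x : UnitAddCircle)).re
        = Real.cos (2 * Real.pi * (2 * j + 1 : ℕ) * x) := by
      rw [fourier_coe_apply, ← Complex.exp_ofReal_mul_I_re]
      congr 2
      push_cast
      ring
    have h2 : 2 * Real.pi * (2 * j + 1 : ℕ) * x = 2 * Real.pi * (2 * j + 1 : ℕ) * (x - round x)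
        + ((2 * j + 1 : ℕ) * round x : ℤ) * (2 * Real.pi) := by
      push_cast
      ring
    rw [h1, h2, Real.cos_add_int_mul_two_pi, ← Real.cos_abs, abs_mul,
      abs_of_nonneg (by positivity : 0 ≤ 2 * Real.pi * ((2 * j + 1 : ℕ) : ℝ))]
  -- The distance to the nearest integer lies in [0, 1/2], and the factor -2/π² turns π²(1/8 - u/2)
  -- into u - 1/4.
  have h := (hasSum_cos_odd (abs_nonneg (x - round x)) (abs_sub_round x)).mul_left
    (-2 / Real.pi ^ 2)
  change HasSum (fun j : ℕ => 2 * circleEigenvalue j * (fourier (2 * j + 1 : ℤ)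
    (x : UnitAddCircle)).re) (‖(x : UnitAddCircle)‖ - 1 / 4)
  rw [UnitAddCircle.norm_eq]
  convert! h using 1
  · ext j
    rw [hcos, circleEigenvalue]
    field_simp
  · field_simp
    ring

theorem hasSum_prod_bool {f : ℕ × Bool → ℝ} {s : ℝ} (hf : Summable f)
    (h : HasSum (fun j => f (j, true) + f (j, false)) s) : HasSum f s := by
  have h1 := hf.hasSum.prod_fiberwise fun j => hasSum_fintype fun b => f (j, b)
  simp only [Fintype.sum_bool] at h1
  rw [← h1.unique h]
  exact hf.hasSum

/-- The factor π^(-2r) of the eigenvalues cancels the one in ζ(2r), so the power sums are rational.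
-/
theorem hasSum_circleEigenvalue_pow {r : ℕ} (hr : r ≠ 0) :
    HasSum (fun j => circleEigenvalue j ^ r)
      (-(1 - 1 / 4 ^ r) * ((2 : ℝ) ^ (2 * r - 1) * bernoulli (2 * r) / Nat.factorial (2 * r))) := by
  have h := (hasSum_one_div_odd_pow hr).mul_left ((-1) ^ r / Real.pi ^ (2 * r))
  have hs : (-1 : ℝ) ^ r * (-1) ^ r = 1 := by rw [← mul_pow]; norm_num
  convert! h using 1
  · ext j
    rw [circleEigenvalue, neg_pow, one_div, one_div, inv_pow, mul_pow, ← pow_mul, ← pow_mul, mul_inv]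
    ring
  · have hpi : Real.pi ^ (2 * r) ≠ 0 := by positivity
    field_simp
    rw [pow_succ]
    linear_combination ((4 ^ r - 1) * (bernoulli (2 * r) : ℝ)) * hs

theorem summable_abs_circleEigenvalue : Summable fun m : ℕ × Bool => |circleEigenvalue m.1| := by
  have h1 : Summable fun j => |circleEigenvalue j| :=
    (by simpa using (hasSum_circleEigenvalue_pow one_ne_zero).summable :
      Summable circleEigenvalue).abs
  rw [summable_prod_of_nonneg fun _ => abs_nonneg _]
  refine ⟨fun j => Summable.of_finite, ?_⟩
  simpa [tsum_fintype] using h1.mul_left 2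

theorem hasSum_oddTrig_dist (x y : UnitAddCircle) :
    HasSum (fun m : ℕ × Bool => circleEigenvalue m.1 * (oddTrig m x * oddTrig m y))
      (dist x y - 1 / 4) := by
  have hb := isBoundedOrthonormal_oddTrig.abs_le
  refine hasSum_prod_bool ?_ ?_
  · refine (summable_abs_circleEigenvalue.mul_right (√2 * √2)).of_norm_bounded fun m => ?_
    rw [norm_mul, norm_mul, Real.norm_eq_abs]
    exact mul_le_mul_of_nonneg_left (mul_le_mul (hb m x) (hb m y) (norm_nonneg _)
      (Real.sqrt_nonneg 2)) (abs_nonneg _)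
  · rw [dist_eq_norm]
    convert! hasSum_norm_unitAddCircle (x - y) using 2 with j
    have h1 : fourier (2 * j + 1 : ℤ) (x - y)
        = fourier (2 * j + 1 : ℤ) x * (starRingEnd ℂ) (fourier (2 * j + 1 : ℤ) y) := by
      rw [← fourier_neg, fourier_apply, fourier_apply, fourier_apply, ← Circle.coe_mul,
        ← AddCircle.toCircle_add]
      congr 2
      rw [smul_sub, neg_smul, sub_eq_add_neg]
    have hsq : √(2 : ℝ) * √2 = 2 := Real.mul_self_sqrt (by norm_num)
    rw [h1]
    simp only [oddTrig, cond_true, cond_false, Complex.mul_re, Complex.conj_re, Complex.conj_im]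
    linear_combination circleEigenvalue j * ((fourier (2 * j + 1 : ℤ) x).re
      * (fourier (2 * j + 1 : ℤ) y).re + (fourier (2 * j + 1 : ℤ) x).im
      * (fourier (2 * j + 1 : ℤ) y).im) * hsq

/-- The weights of the limiting chi-squared sum for the circle. -/
noncomputable def circleWeight (m : ℕ × Bool) : ℝ :=
  2 * (1 / 4) * circleEigenvalue m.1 + circleEigenvalue m.1 ^ 2

theorem summable_abs_circleWeight : Summable fun m => |circleWeight m| :=
  summable_abs_quadratic (1 / 4) summable_abs_circleEigenvalue

/-- The powers of λ/2 + λ² expand into power sums of the eigenvalues λ of orders 1 to 6, doubled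
because each frequency carries a sine and a cosine. -/
theorem hasSum_circleWeight : HasSum circleWeight (-5 / 48) ∧
    HasSum (fun m => circleWeight m ^ 2) (269 / 80640) ∧
    HasSum (fun m => circleWeight m ^ 3) (2 * (691 / 638668800 - 3 / 2 * (31 / 2903040)
      + 3 / 4 * (17 / 161280) - 1 / 8 * (1 / 960))) := by
  obtain ⟨b4, b6, b8, b10, b12⟩ := bernoulli_values
  have s1 := hasSum_circleEigenvalue_pow (r := 1) (by norm_num)
  have s2 := hasSum_circleEigenvalue_pow (r := 2) (by norm_num)
  have s3 := hasSum_circleEigenvalue_pow (r := 3) (by norm_num)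
  have s4 := hasSum_circleEigenvalue_pow (r := 4) (by norm_num)
  have s5 := hasSum_circleEigenvalue_pow (r := 5) (by norm_num)
  have s6 := hasSum_circleEigenvalue_pow (r := 6) (by norm_num)
  norm_num [bernoulli_two, b4, b6, b8, b10, b12, Nat.factorial] at s1 s2 s3 s4 s5 s6
  have hc := summable_abs_circleWeight
  have hpow : ∀ r : ℕ, Summable fun m => circleWeight m ^ (r + 1) := fun r => by
    refine (hc.mul_left ((∑' m, |circleWeight m|) ^ r)).of_norm_bounded fun m => ?_
    rw [norm_pow, Real.norm_eq_abs, pow_succ]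
    gcongr
    exact hc.le_tsum m fun _ _ => abs_nonneg _
  refine ⟨hasSum_prod_bool hc.of_abs ?_, hasSum_prod_bool (hpow 1) ?_,
    hasSum_prod_bool (hpow 2) ?_⟩
  · convert! s1.add (s2.mul_left 2) using 1
    · ext j; simp only [circleWeight]; ring
    · norm_num
  · convert! ((s2.mul_left (1 / 2)).add (s3.mul_left 2)).add (s4.mul_left 2) using 1
    · ext j; simp only [circleWeight]; ring
    · norm_num
  · convert! (((s3.mul_left (1 / 4)).add (s4.mul_left (3 / 2))).add (s5.mul_left 3)).add
      (s6.mul_left 2) using 1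
    · ext j; simp only [circleWeight]; ring
    · norm_num

end Distance

/-! ### Convergence of variances and affine normalization. -/

section Standardization

variable {Ω Ω' : Type*} {mΩ : MeasurableSpace Ω} {mΩ' : MeasurableSpace Ω'}
  {P : Measure Ω} [IsProbabilityMeasure P] {P' : Measure Ω'} [IsProbabilityMeasure P']

/-- The L⁴ bound makes the squares bounded in L², so convergence of means applies to them too. -/
theorem tendsto_variance_of_tendstoInDistribution {V : ℕ → Ω → ℝ} {V' : Ω' → ℝ}
    (h : TendstoInDistribution V atTop V' (fun _ => P) P') {C : ℝ}
    (hC : ∀ n, eLpNorm (V n) 4 P ≤ ENNReal.ofReal C) (hV' : MemLp V' 4 P') :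
    Tendsto (fun n => ∫ ω, V n ω ∂P) atTop (𝓝 (∫ ω, V' ω ∂P')) ∧
      Tendsto (fun n => variance (V n) P) atTop (𝓝 (variance V' P')) := by
  have hm : ∀ n, MemLp (V n) 4 P := fun n =>
    ⟨(h.forall_aemeasurable n).aestronglyMeasurable, (hC n).trans_lt ENNReal.ofReal_lt_top⟩
  have h24 : (2 : ℝ≥0∞) ≤ 4 := by norm_num
  have t1 : Tendsto (fun n => ∫ ω, V n ω ∂P) atTop (𝓝 (∫ ω, V' ω ∂P')) :=
    tendsto_integral_of_tendstoInDistribution h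
      (fun n => (eLpNorm_le_eLpNorm_of_exponent_le h24 (hm n).1).trans (hC n))
      (hV'.mono_exponent h24)
  have h224 : (2 : ℝ≥0∞) * 2 = 4 := by norm_num
  have t2 : Tendsto (fun n => ∫ ω, V n ω ^ 2 ∂P) atTop (𝓝 (∫ ω, V' ω ^ 2 ∂P')) := by
    refine tendsto_integral_of_tendstoInDistribution (C := (max C 0) ^ 2)
      (h.continuous_comp (g := fun x => x ^ 2) (by fun_prop)) (fun n => ?_) ?_
    · rw [eLpNorm_sq, h224, ENNReal.ofReal_pow (le_max_right _ _)]
      exact pow_le_pow_left₀ zero_le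
        ((hC n).trans (ENNReal.ofReal_le_ofReal (le_max_left _ _))) 2
    · refine ⟨hV'.1.pow 2, ?_⟩
      rw [eLpNorm_sq, h224]
      exact ENNReal.pow_lt_top hV'.2
  refine ⟨t1, ?_⟩
  rw [variance_eq_sub (hV'.mono_exponent h24)]
  simp only [fun n => variance_eq_sub ((hm n).mono_exponent h24)]
  exact t2.sub (t1.pow 2)

theorem MeasureTheory.TendstoInDistribution.affine {V : ℕ → Ω → ℝ} {V' : Ω' → ℝ}
    (h : TendstoInDistribution V atTop V' (fun _ => P) P') {b s : ℕ → ℝ} {b' s' : ℝ}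
    (hb : Tendsto b atTop (𝓝 b')) (hs : Tendsto s atTop (𝓝 s')) :
    TendstoInDistribution (fun n ω => (V n ω - b n) * s n) atTop
      (fun ω => (V' ω - b') * s') (fun _ => P) P' := by
  refine h.continuous_comp_prodMk_of_tendstoInMeasure_const (E' := ℝ × ℝ)
    (g := fun y : ℝ × (ℝ × ℝ) => (y.1 - y.2.1) * y.2.2) (by fun_prop)
    (Y := fun n _ => (b n, s n)) (c := (b', s')) ?_ (fun n => aemeasurable_const)
  exact tendstoInMeasure_of_tendsto_ae (fun n => aestronglyMeasurable_const)
    (ae_of_all _ fun ω => hb.prodMk_nhds hs)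

end Standardization

/-! ### The path observable as a kernel statistic. -/

section Observable

theorem distProd_path3 {S : Type*} [PseudoMetricSpace S] (x : Fin 3 → S) :
    Multigraph.path3.distProd x = min 1 (dist (x 0) (x 1)) * min 1 (dist (x 1) (x 2)) := by
  simp [Multigraph.distProd, Multigraph.path3]

theorem integral_empiricalMeasure {S : Type*} [MeasurableSpace S] {n : ℕ} (x : ℕ → S)
    {f : S → ℝ} (hf : Measurable f) :
    ∫ y, f y ∂(empiricalMeasure n x) = (n : ℝ)⁻¹ * ∑ i ∈ Finset.range n, f (x i) := by
  rw [empiricalMeasure, integral_smul_measure, integral_finsetSum_measure]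
  · simp [integral_dirac' _ _ hf.stronglyMeasurable]
  · exact fun i _ => integrable_dirac' hf.stronglyMeasurable (by finiteness)

theorem isFiniteMeasure_empiricalMeasure {S : Type*} [MeasurableSpace S] (n : ℕ) (x : ℕ → S) :
    IsFiniteMeasure (empiricalMeasure n x) := by
  rcases eq_or_ne n 0 with rfl | hn
  · have : empiricalMeasure 0 x = 0 := by simp [empiricalMeasure]
    rw [this]; infer_instance
  · refine ⟨?_⟩
    simp only [empiricalMeasure, Measure.smul_apply, Measure.finsetSum_apply, measure_univ,
      Finset.sum_const, Finset.card_range, smul_eq_mul, nsmul_eq_mul, mul_one]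
    rw [ENNReal.inv_mul_cancel (by exact_mod_cast hn) (by finiteness)]
    exact ENNReal.one_lt_top

variable {S : Type*} [PseudoMetricSpace S] [SecondCountableTopology S] [MeasurableSpace S]
  [OpensMeasurableSpace S]

theorem monomialObservable_path3 (μ : Measure S) [IsFiniteMeasure μ] :
    monomialObservable Multigraph.path3 μ = ∫ y, (∫ z, min 1 (dist y z) ∂μ) ^ 2 ∂μ := by
  -- Coordinate 1 is the middle vertex; once it is fixed, the two end vertices are independent and
  -- give the same factor.
  have hmp := measurePreserving_piFinSuccAbove (fun _ : Fin 3 => μ) 1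
  have hm : Measurable fun x : Fin 3 → S => Multigraph.path3.distProd x := by
    simp only [distProd_path3]
    fun_prop
  rw [monomialObservable, ← hmp.symm.integral_comp']
  rw [integral_prod]
  · refine integral_congr_ae (ae_of_all _ fun y => ?_)
    have h := integral_fintype_prod_eq_prod (μ := fun _ : Fin 2 => μ)
      (f := fun _ : Fin 2 => fun z : S => min 1 (dist y z))
    simp only [Fin.prod_univ_two] at h
    beta_reduce
    rw [sq, ← h]
    refine integral_congr_ae (ae_of_all _ fun z => ?_)
    simp only [distProd_path3]
    rw [dist_comm y (z 0)]
    rfl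
  · refine Integrable.of_bound
      (hm.comp (MeasurableEquiv.measurable _)).aestronglyMeasurable 1 (ae_of_all _ fun x => ?_)
    rw [distProd_path3, Real.norm_eq_abs, abs_of_nonneg (by positivity)]
    exact mul_le_one₀ (min_le_left _ _) (by positivity) (min_le_left _ _)

theorem sampleObservable_path3 {Ω : Type*} (X : ℕ → Ω → S) (n : ℕ) (ω : Ω) :
    sampleObservable Multigraph.path3 X n ω
      = kernelStatistic (fun x y => min 1 (dist x y)) n (X · ω) := by
  have := isFiniteMeasure_empiricalMeasure n (X · ω)
  rw [sampleObservable, monomialObservable_path3]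
  have h : ∀ y, ∫ z, min 1 (dist y z) ∂(empiricalMeasure n (X · ω))
      = (n : ℝ)⁻¹ * ∑ i ∈ Finset.range n, min 1 (dist y (X i ω)) := fun y =>
    integral_empiricalMeasure _ (by fun_prop)
  simp only [h]
  rw [integral_empiricalMeasure _ (by fun_prop)]
  rfl

end Observable

/-! ### The observable of the circle itself. -/

section Circle

theorem dist_unitAddCircle_le (x y : UnitAddCircle) : dist x y ≤ 1 / 2 := by
  rw [dist_eq_norm]
  simpa using AddCircle.norm_le_half_period (1 : ℝ) (x := x - y) one_ne_zero

theorem min_one_dist_unitAddCircle (x y : UnitAddCircle) : min 1 (dist x y) = dist x y :=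
  min_eq_right ((dist_unitAddCircle_le x y).trans (by norm_num))

theorem isProbabilityMeasure_unitAddCircle :
    IsProbabilityMeasure (volume : Measure UnitAddCircle) := ⟨UnitAddCircle.measure_univ⟩

theorem integral_dist_unitAddCircle (y : UnitAddCircle) : ∫ z, dist y z = 1 / 4 := by
  have h1 : ∫ z, dist y z = ∫ z : UnitAddCircle, ‖z‖ := by
    simp only [dist_eq_norm]
    exact integral_sub_left_eq_self (fun z : UnitAddCircle => ‖z‖) volume y
  rw [h1, ← AddCircle.intervalIntegral_preimage 1 (-(1 / 2))]
  have h2 : ∀ a ∈ Set.uIcc (-(1 / 2) : ℝ) (-(1 / 2) + 1), ‖(a : UnitAddCircle)‖ = |a| := by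
    intro a ha
    rw [Set.uIcc_of_le (by norm_num)] at ha
    refine AddCircle.norm_coe_eq_abs_iff (p := 1) (x := a) one_ne_zero |>.2 ?_
    rw [abs_le]; constructor <;> norm_num <;> linarith [ha.1, ha.2]
  rw [intervalIntegral.integral_congr h2]
  rw [← intervalIntegral.integral_add_adjacent_intervals (b := 0)
    (continuous_abs.intervalIntegrable _ _) (continuous_abs.intervalIntegrable _ _)]
  have h3 : ∫ a in (-(1 / 2) : ℝ)..0, |a| = ∫ a in (-(1 / 2) : ℝ)..0, -a :=
    intervalIntegral.integral_congr fun a ha => by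
      rw [Set.uIcc_of_le (by norm_num)] at ha
      exact abs_of_nonpos ha.2
  have h4 : ∫ a in (0 : ℝ)..(-(1 / 2) + 1), |a| = ∫ a in (0 : ℝ)..(-(1 / 2) + 1), a :=
    intervalIntegral.integral_congr fun a ha => by
      rw [Set.uIcc_of_le (by norm_num)] at ha
      exact abs_of_nonneg ha.1
  rw [h3, h4, intervalIntegral.integral_neg, integral_id, integral_id]
  norm_num

theorem monomialObservable_path3_unitAddCircle :
    monomialObservable Multigraph.path3 (volume : Measure UnitAddCircle) = (1 / 4) ^ 2 := by
  have := isProbabilityMeasure_unitAddCircle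
  rw [monomialObservable_path3]
  simp only [min_one_dist_unitAddCircle, integral_dist_unitAddCircle]
  simp

end Circle

/-! ### The third cumulant and its vanishing for Gaussian laws. -/

section Cumulant

/-- For a centered variable the moment series minus 1 starts at order 2, so its powers with j ≥ 2
start at order at least 4 and only j = 1 contributes. -/
theorem cumulant_three_of_centered {Ω : Type*} [MeasurableSpace Ω] {P : Measure Ω}
    [IsProbabilityMeasure P] {Y : Ω → ℝ} (h : ∫ ω, Y ω ∂P = 0) :
    cumulant 3 Y P = ∫ ω, Y ω ^ 3 ∂P := by
  have hdvd : (PowerSeries.X : PowerSeries ℝ) ^ 2 ∣ momentSeries Y P - 1 := by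
    rw [PowerSeries.X_pow_dvd_iff]
    intro m hm
    interval_cases m
    · simp [momentSeries, moment]
    · simpa [momentSeries, moment, PowerSeries.coeff_one] using h
  have hpow : ∀ j, 2 ≤ j → PowerSeries.coeff 3 ((momentSeries Y P - 1) ^ j) = 0 := fun j hj => by
    refine PowerSeries.X_pow_dvd_iff.1 ?_ 3 (by norm_num : 3 < 4)
    refine (?_ : (PowerSeries.X : PowerSeries ℝ) ^ 4 ∣ (PowerSeries.X ^ 2) ^ j).trans
      (pow_dvd_pow_of_dvd hdvd j)
    rw [← pow_mul]
    exact pow_dvd_pow _ (by lia)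
  rw [cumulant, show Finset.Icc 1 3 = {1, 2, 3} from rfl, Finset.sum_insert (by decide),
    Finset.sum_insert (by decide), Finset.sum_singleton, hpow 2 le_rfl, hpow 3 (by norm_num)]
  simp [momentSeries, moment, PowerSeries.coeff_one, Nat.factorial]
  ring

/-- The law is symmetric and the cube is odd. -/
theorem integral_cube_gaussianReal_zero (v : NNReal) : ∫ y, y ^ 3 ∂(gaussianReal 0 v) = 0 := by
  have h : ∫ y, y ^ 3 ∂(gaussianReal 0 v) = ∫ y, (-y) ^ 3 ∂(gaussianReal 0 v) := by
    conv_lhs => rw [← neg_zero, ← gaussianReal_map_neg]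
    rw [integral_map (by fun_prop) (by fun_prop)]
  have h2 : ∀ y : ℝ, (-y) ^ 3 = -(y ^ 3) := fun y => by ring
  simp only [h2, integral_neg] at h
  linarith

theorem ne_gaussianReal_of_integral_cube_ne_zero {ν : Measure ℝ} (h1 : ∫ y, y ∂ν = 0)
    (h3 : ∫ y, y ^ 3 ∂ν ≠ 0) (m : ℝ) (v : NNReal) : ν ≠ gaussianReal m v := by
  rintro rfl
  rw [integral_id_gaussianReal] at h1
  subst h1
  exact h3 (integral_cube_gaussianReal_zero v)

end Cumulant

/-! ### The standardized limit law and its constants. -/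

section Limit

/-- The limit in law of the standardized observable of the samples of the circle. -/
noncomputable def circleLimit (ξ : ℕ × Bool → ℝ) : ℝ :=
  -- The mean is -5/48, and 24√(70/269) is the inverse of the standard deviation √(269/40320), as
  -- 40320 = 24² · 70.
  (weightedChiSq circleWeight ξ - -5 / 48) * (24 * √(70 / 269))

theorem measurable_circleLimit : Measurable circleLimit :=
  ((measurable_weightedChiSq circleWeight).sub_const _).mul_const _

theorem sq_scale : (24 * √(70 / 269)) ^ 2 = (40320 / 269 : ℝ) := by
  rw [mul_pow, Real.sq_sqrt (by norm_num)]
  norm_num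

theorem inv_sqrt_variance : (√(269 / 40320))⁻¹ = 24 * √(70 / 269) := by
  rw [← Real.sqrt_inv, inv_div, ← sq_scale, Real.sqrt_sq (by positivity)]

theorem hasCenteredMoments_circleWeight :
    HasCenteredMoments (fun ξ => weightedChiSq circleWeight ξ - -5 / 48) (269 / 40320)
      (8 * (2 * (691 / 638668800 - 3 / 2 * (31 / 2903040) + 3 / 4 * (17 / 161280)
        - 1 / 8 * (1 / 960)))) (gaussianFamily (ℕ × Bool)) := by
  obtain ⟨h1, h2, h3⟩ := hasSum_circleWeight
  have h := hasCenteredMoments_weightedChiSq summable_abs_circleWeight h2 h3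
  rw [h1.tsum_eq] at h
  convert h using 1
  norm_num

theorem memLp_circleLimit (k : ℕ) : MemLp circleLimit k (gaussianFamily (ℕ × Bool)) := by
  -- The exponent k + 1 meets the requirement p ≥ 1 even for k = 0.
  have h : MemLp (weightedChiSq circleWeight) ((k + 1 : ℕ) : NNReal) (gaussianFamily (ℕ × Bool)) :=
    memLp_weightedChiSq summable_abs_circleWeight (by simp)
  have h' : MemLp (weightedChiSq circleWeight) k (gaussianFamily (ℕ × Bool)) :=
    h.mono_exponent (by exact_mod_cast k.le_succ)
  exact MemLp.mul_const (h'.sub (memLp_const _)) _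

theorem integral_circleLimit : ∫ ξ, circleLimit ξ ∂(gaussianFamily (ℕ × Bool)) = 0 := by
  simp only [circleLimit]
  rw [integral_mul_const, hasCenteredMoments_circleWeight.integral_eq, zero_mul]

theorem integral_circleLimit_sq : ∫ ξ, circleLimit ξ ^ 2 ∂(gaussianFamily (ℕ × Bool)) = 1 := by
  simp only [circleLimit, mul_pow _ _ 2]
  rw [integral_mul_const, hasCenteredMoments_circleWeight.integral_sq, ← mul_pow, sq_scale]
  norm_num

theorem integral_circleLimit_cube : ∫ ξ, circleLimit ξ ^ 3 ∂(gaussianFamily (ℕ × Bool))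
    = -(168836 / 44385) * √(70 / 269) := by
  simp only [circleLimit, mul_pow _ _ 3]
  rw [integral_mul_const, hasCenteredMoments_circleWeight.integral_cube, ← mul_pow, pow_succ,
    sq_scale]
  ring

theorem abs_third_cumulant_sub_lt :
    |-(168836 / 44385) * √(70 / 269) - (-1.94044 : ℝ)| < 0.00001 := by
  have h1 : (0.510120 : ℝ) < √(70 / 269) := Real.lt_sqrt_of_sq_lt (by norm_num)
  have h2 : √(70 / 269) < (0.510121 : ℝ) := (Real.sqrt_lt' (by norm_num)).2 (by norm_num)
  rw [abs_lt]
  constructor <;> linarith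

end Limit

/-! ### Fluctuations of the samples of the circle. -/

section Fluctuation

theorem sampleObservable_path3_unitAddCircle {Ω : Type*} (X : ℕ → Ω → UnitAddCircle)
    (n : ℕ) (ω : Ω) :
    sampleObservable Multigraph.path3 X n ω = kernelStatistic dist n (X · ω) := by
  rw [sampleObservable_path3]
  simp only [min_one_dist_unitAddCircle]

variable {Ω : Type*} [MeasurableSpace Ω] {P : Measure Ω} {X : ℕ → Ω → UnitAddCircle}

theorem aemeasurable_sampleObservable
    (hX : ∀ i, HasLaw (X i) (volume : Measure UnitAddCircle) P) (n : ℕ) :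
    AEMeasurable (sampleObservable Multigraph.path3 X n) P := by
  refine (aemeasurable_kernelStatistic hX measurable_dist n).congr (ae_of_all _ fun ω => ?_)
  exact (sampleObservable_path3_unitAddCircle X n ω).symm

variable [IsProbabilityMeasure P]

/-- The rescaled fluctuation of the observable of the samples of the circle converges in law. -/
theorem tendstoInDistribution_sampleObservable (hind : iIndepFun X P)
    (hX : ∀ i, HasLaw (X i) (volume : Measure UnitAddCircle) P) :
    TendstoInDistribution
      (fun (n : ℕ) ω => (n : ℝ) * (sampleObservable Multigraph.path3 X n ω - (1 / 4) ^ 2)) atTop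
      (weightedChiSq circleWeight) (fun _ => P) (gaussianFamily (ℕ × Bool)) := by
  have := isProbabilityMeasure_unitAddCircle
  simp only [sampleObservable_path3_unitAddCircle]
  exact tendstoInDistribution_fluctuation hind hX measurable_dist hasSum_oddTrig_dist
    (Real.sqrt_nonneg 2) isBoundedOrthonormal_oddTrig summable_abs_circleEigenvalue

theorem exists_eLpNorm_sampleObservable_le (hind : iIndepFun X P)
    (hX : ∀ i, HasLaw (X i) (volume : Measure UnitAddCircle) P) :
    ∃ C : ℝ, ∀ n : ℕ, eLpNorm
      (fun ω => (n : ℝ) * (sampleObservable Multigraph.path3 X n ω - (1 / 4) ^ 2)) 4 P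
        ≤ ENNReal.ofReal C := by
  simp only [sampleObservable_path3_unitAddCircle]
  exact exists_eLpNorm_fluctuation_le hind hX hasSum_oddTrig_dist
    (Real.sqrt_nonneg 2) isBoundedOrthonormal_oddTrig summable_abs_circleEigenvalue

theorem integrable_sampleObservable
    (hX : ∀ i, HasLaw (X i) (volume : Measure UnitAddCircle) P) (n : ℕ) :
    Integrable (sampleObservable Multigraph.path3 X n) P := by
  refine Integrable.of_bound (aemeasurable_sampleObservable hX n).aestronglyMeasurable 1
    (ae_of_all _ fun ω => ?_)
  have hmean : ∀ f : ℕ → ℝ, (∀ i, 0 ≤ f i ∧ f i ≤ 1) →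
      0 ≤ (n : ℝ)⁻¹ * ∑ i ∈ Finset.range n, f i ∧ (n : ℝ)⁻¹ * ∑ i ∈ Finset.range n, f i ≤ 1 := by
    intro f hf
    refine ⟨mul_nonneg (by positivity) (Finset.sum_nonneg fun i _ => (hf i).1), ?_⟩
    refine inv_mul_le_one_of_le₀ ?_ (by positivity)
    simpa using Finset.sum_le_card_nsmul (Finset.range n) f 1 fun i _ => (hf i).2
  rw [sampleObservable_path3_unitAddCircle, kernelStatistic]
  have h := hmean (fun j => ((n : ℝ)⁻¹ * ∑ i ∈ Finset.range n, dist (X j ω) (X i ω)) ^ 2)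
    fun j => by
      have h' := hmean (fun i => dist (X j ω) (X i ω)) fun i =>
        ⟨dist_nonneg, (dist_unitAddCircle_le _ _).trans (by norm_num)⟩
      exact ⟨sq_nonneg _, pow_le_one₀ h'.1 h'.2⟩
  rw [Real.norm_eq_abs, abs_of_nonneg h.1]
  exact h.2

theorem variance_const_mul_sub_const {Y : Ω → ℝ} (hY : AEMeasurable Y P) (c b : ℝ) :
    variance (fun ω => c * (Y ω - b)) P = c ^ 2 * variance Y P := by
  rw [variance_const_mul, variance_sub_const hY.aestronglyMeasurable]

/-- It rewrites a standardized quantity in terms of the rescaled fluctuation, whose variance has a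
positive limit. -/
theorem div_sqrt_variance_eq {Y : Ω → ℝ} (hY : AEMeasurable Y P) {c : ℝ} (hc : 0 < c)
    (b u : ℝ) :
    u / √(variance Y P) = c * u * (√(variance (fun ω => c * (Y ω - b)) P))⁻¹ := by
  rw [variance_const_mul_sub_const hY, Real.sqrt_mul (sq_nonneg c), Real.sqrt_sq hc.le, mul_inv]
  field_simp

end Fluctuation

/-! ### Assembly of the theorem. -/

theorem mainTheorem5 :
    ∃ ν : ProbabilityMeasure ℝ,
      (∀ k : ℕ, MemLp (fun y : ℝ => y) k (ν : Measure ℝ)) ∧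
      ∫ y, y ∂(ν : Measure ℝ) = 0 ∧
      variance (fun y : ℝ => y) (ν : Measure ℝ) = 1 ∧
      cumulant 3 (fun y : ℝ => y) (ν : Measure ℝ) = -(168836 / 44385) * √(70 / 269) ∧
      |-(168836 / 44385) * √(70 / 269) - (-1.94044 : ℝ)| < 0.00001 ∧
      (∀ (m : ℝ) (v : NNReal), (ν : Measure ℝ) ≠ gaussianReal m v) ∧
      ∀ {Ω : Type*} [MeasurableSpace Ω] (P : Measure Ω) [IsProbabilityMeasure P]
        (X : ℕ → Ω → UnitAddCircle),
        iIndepFun X P →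
        (∀ i, HasLaw (X i) (volume : Measure UnitAddCircle) P) →
        Tendsto (fun n : ℕ => (n : ℝ) ^ 2 * variance (sampleObservable Multigraph.path3 X n) P)
          atTop (𝓝 (269 / 40320)) ∧
        TendstoInDistribution
          (fun (n : ℕ) ω =>
            (sampleObservable Multigraph.path3 X n ω
                - ∫ ω', sampleObservable Multigraph.path3 X n ω' ∂P)
              / √(variance (sampleObservable Multigraph.path3 X n) P))
          atTop (fun y : ℝ => y) (fun _ => P) (ν : Measure ℝ) ∧
        TendstoInDistribution
          (fun (n : ℕ) ω =>
            (sampleObservable Multigraph.path3 X n ω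
                - monomialObservable Multigraph.path3 (volume : Measure UnitAddCircle))
              / √(variance (sampleObservable Multigraph.path3 X n) P))
          atTop (fun y : ℝ => y - 5 / 2 * √(70 / 269)) (fun _ => P) (ν : Measure ℝ) := by
  have hmap : IsProbabilityMeasure ((gaussianFamily (ℕ × Bool)).map circleLimit) :=
    Measure.isProbabilityMeasure_map measurable_circleLimit.aemeasurable
  have hintg : ∀ k : ℕ, ∫ y, y ^ k ∂((gaussianFamily (ℕ × Bool)).map circleLimit)
      = ∫ ξ, circleLimit ξ ^ k ∂(gaussianFamily (ℕ × Bool)) := fun k =>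
    integral_map measurable_circleLimit.aemeasurable (by fun_prop)
  have h1 : ∫ y, y ∂((gaussianFamily (ℕ × Bool)).map circleLimit) = 0 := by
    simpa only [pow_one, integral_circleLimit] using hintg 1
  have h3 := (hintg 3).trans integral_circleLimit_cube
  refine ⟨⟨_, hmap⟩, fun k => ?_, h1, ?_, ?_, abs_third_cumulant_sub_lt,
    ne_gaussianReal_of_integral_cube_ne_zero h1 ?_, ?_⟩
  · exact (memLp_map_measure_iff aestronglyMeasurable_id
      measurable_circleLimit.aemeasurable).2 (memLp_circleLimit k)
  · exact (variance_of_integral_eq_zero aemeasurable_id h1).trans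
      ((hintg 2).trans integral_circleLimit_sq)
  · exact (cumulant_three_of_centered h1).trans h3
  · rw [ProbabilityMeasure.coe_mk, h3]
    have : 0 < √(70 / 269) := Real.sqrt_pos.2 (by norm_num)
    exact mul_ne_zero (by norm_num) this.ne'
  intro Ω _ P _ X hind hX
  have hlim := tendstoInDistribution_sampleObservable hind hX
  obtain ⟨C, hC⟩ := exists_eLpNorm_sampleObservable_le hind hX
  have hmem : MemLp (weightedChiSq circleWeight) 4 (gaussianFamily (ℕ × Bool)) :=
    memLp_weightedChiSq (p := 4) summable_abs_circleWeight (by norm_num)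
  obtain ⟨tmean, tvar⟩ := tendsto_variance_of_tendstoInDistribution hlim hC hmem
  have hW := hasCenteredMoments_circleWeight
  have hmean : ∫ ξ, weightedChiSq circleWeight ξ ∂(gaussianFamily (ℕ × Bool)) = -5 / 48 := by
    have h := hW.integral_eq
    rw [integral_sub (hmem.integrable (by norm_num)) (integrable_const _)] at h
    simpa [sub_eq_zero] using h
  have hvar : variance (weightedChiSq circleWeight) (gaussianFamily (ℕ × Bool)) = 269 / 40320 := by
    rw [variance_eq_integral hmem.1.aemeasurable, hmean]
    exact hW.integral_sq
  rw [hmean] at tmean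
  rw [hvar] at tvar
  have ts := (tvar.sqrt.inv₀ (by positivity))
  rw [inv_sqrt_variance] at ts
  have hY := aemeasurable_sampleObservable hX
  have hmeanY : ∀ n : ℕ, ∫ ω, (n : ℝ) * (sampleObservable Multigraph.path3 X n ω - (1 / 4) ^ 2) ∂P
      = n * (∫ ω, sampleObservable Multigraph.path3 X n ω ∂P - (1 / 4) ^ 2) := fun n => by
    rw [integral_const_mul, integral_sub (integrable_sampleObservable hX n) (integrable_const _)]
    simp
  have hzero : ∀ ω, sampleObservable Multigraph.path3 X 0 ω = 0 := fun ω => by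
    rw [sampleObservable_path3_unitAddCircle, kernelStatistic]
    simp
  -- For n = 0 the variance is zero and division by zero gives 0 on both sides, so the identities
  -- below hold for every `n` and not just eventually.
  have hvar0 : variance (sampleObservable Multigraph.path3 X 0) P = 0 := by
    rw [show sampleObservable Multigraph.path3 X 0 = 0 from funext hzero, variance_zero]
  refine ⟨?_, ?_, ?_⟩
  · simpa only [variance_const_mul_sub_const (hY _)] using tvar
  · have h := hlim.affine tmean ts
    have h' := tendstoInDistribution_of_map_eq h (V'' := fun y : ℝ => y)
      (P'' := (gaussianFamily (ℕ × Bool)).map circleLimit) aemeasurable_id Measure.map_id.symm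
    convert! h' using 3 with n ω
    rcases n.eq_zero_or_pos with rfl | hn
    · rw [hvar0]; simp
    · rw [div_sqrt_variance_eq (hY n) (Nat.cast_pos.2 hn) ((1 / 4) ^ 2), hmeanY]
      ring
  -- Here nothing is subtracted in the limit, so the mean -5/48 survives; times 24√(70/269) it is
  -- the shift -(5/2)√(70/269).
  · have h := hlim.affine (tendsto_const_nhds (x := 0)) ts
    have h' := tendstoInDistribution_of_map_eq h (V'' := fun y : ℝ => y - 5 / 2 * √(70 / 269))
      (P'' := (gaussianFamily (ℕ × Bool)).map circleLimit) (by fun_prop) ?_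
    · convert! h' using 3 with n ω
      rcases n.eq_zero_or_pos with rfl | hn
      · rw [hvar0]; simp
      · rw [div_sqrt_variance_eq (hY n) (Nat.cast_pos.2 hn) ((1 / 4) ^ 2),
          monomialObservable_path3_unitAddCircle, sub_zero]
    · rw [Measure.map_map (by fun_prop) measurable_circleLimit]
      congr 1
      ext ξ
      simp only [Function.comp_apply, circleLimit]
      ring
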